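/- Let $p$ be a prime and $n\ge 0$ an integer. Let $\mathrm{UT}_n(\mathbb F_p)$ be the group of upper triangular $n\times n$ matrices over $\mathbb F_p$ with ones on the diagonal, and let $e_{i,j}$ denote the matrix units. Write $[[n]]=\{(i,j) : 1\le i<j\le n\}$ and $i\to j$ for $(i,j)\in[[n]]$. Put $(i\to j)\preceq_L(r\to s)$ if $r\le i$ and $j=s$; $(i\to j)\preceq_R(r\to s)$ if $i=r$ and $j\le s$; and $(i\to j)\preceq(r\to s)$ if $r\le i<j\le s$. A *set partition* of $[n]$ is a subset of $[[n]]$ that is an antichain for $\preceq_L$ and for $\preceq_R$; it is *nonnesting* if it is also an antichain for $\preceq$. For $\lambda\subseteq[[n]]$ and $\ell\ge0$ let $\lambda^{\uparrow\ell}$ be the set of $(r\to s)\in[[n]]$ such that $(r\to s)\succeq(i\to j)$ and $s-r\ge j-i+\ell$ for some $(i\to j)\in\lambda$. *Tight splices.* A tight splice is a set $S=\lambda\sqcup\nu$, where $\lambda$ is a nonnesting set partition and $\nu$ is a set partition disjoint from $\lambda$, such that: (S1) for each $(i\to k)\in\nu$ there is $j$ with $i<j<k$ such that $(i\to j)\in\lambda$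 or $(j\to k)\in\lambda$; (S2) for all $j<k$, there is $i$ with $(i\to k)\in\nu$ and $(i\to j)\in\lambda$ if and only if there is $l$ with $(k\to l)\in\lambda$ and $(j\to l)\in\nu$; (T) $S\cap\lambda^{\uparrow2}=\emptyset$. Here $\lambda$ is the set of $\preceq$-minimal elements of $S$. A *binding* of $S$ is a tuple $(i,j,k,l)$ with $(i\to j),(k\to l)\in\lambda$, $(i\to k),(j\to l)\in\nu$ and $j<k$. The *columns* of $S$ are the classes of the equivalence relation on $\lambda$ generated by $(i\to j)\sim(k\to l)$ for all bindings $(i,j,k,l)$; the *rows* are the classes of the equivalence relation on $\nu$ generated by $(i\to k)\sim(j\to l)$ for all bindings $(i,j,k,l)$. Let $\mathrm{CR}(S)$ be the disjoint union of the set of columns and the set of rows, totally ordered as follows: all columns precede all rows; two columns (or two rows) in different connected components of the graph on $[n]$ with edge set $S$ are ordered by the least vertices of their components; two columns (or two rows) in the same component are ordered by their least left endpoints. (In the grid drawing of $S$, with the edges of $\lambda$ horizontal and those of $\nu$ vertical, this lists, component by component, the columns from left to right, and then the rows from top to bottom.) A *labeling* of $S$ is a function $\sigma$ from the set of bindings of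 $S$ to $\mathbb F_p^\times$. *Labeled loopless binary matroids.* A labeled loopless binary matroid $(M,\tau)$ on a finite totally ordered set $K$ is given by its graph model $M=(U,V,E)$, where $K=U\sqcup V$, $E\subseteq U\times V$, each $v\in V$ lies on at least one edge $(u,v)\in E$, and $u<v$ for every $(u,v)\in E$, together with a function $\tau:E\to\mathbb F_p^\times$. *The subspace $\mathfrak n_{S,\sigma,M,\tau}$.* Let $S=\lambda\sqcup\nu$ be a tight splice with a labeling $\sigma$. Let $\mathfrak D_{S,\sigma}$ be the $\mathbb F_p$-span of the $e_{r,s}$ with $(r\to s)\in\lambda^{\uparrow0}\setminus S$ and of the $e_{i,k}-\sigma(i,j,k,l)\,e_{j,l}$ for all bindings $(i,j,k,l)$. For a row $R$ let $b_R=e_{i,k}$, where $(i\to k)\in R$ has $i$ minimal. For a column $C$ let $$b_C=\sum_{(i\to j)\in C}\Big(\prod\sigma(r,s,t,u)\Big)e_{i,j},$$ the product being over the bindings $(r,s,t,u)$ with $(r\to s),(t\to u)\in C$ and $t\le i$. For a labeled loopless binary matroid $(M,\tau)$ on $\mathrm{CR}(S)$ with $M=(U,V,E)$ let $$\mathfrak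 n_{S,\sigma,M,\tau}=\operatorname{span}_{\mathbb F_p}\Big\{\,b_X+\sum_{Y:\,(X,Y)\in E}\tau(X,Y)\,b_Y\;:\;X\in U,\ X\text{ is a column or }(X,Y)\in E\text{ for some }Y\in V\Big\}+\mathfrak D_{S,\sigma}.$$ **Statement.** The map $(S,\sigma,M,\tau)\mapsto 1+\mathfrak n_{S,\sigma,M,\tau}$ is a bijection from the set of all quadruples, where $S$ is a tight splice with labeling $\sigma$ and $(M,\tau)$ is a labeled loopless binary matroid on $\mathrm{CR}(S)$, onto the set of all normal subgroups of $\mathrm{UT}_n(\mathbb F_p)$. -/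

import Mathlib

/-! ### The poset of edges `i → j`, `i < j`

Vertices are the elements of `Fin n`, and an edge `i → j` is the pair `(i, j)`. -/

namespace SpliceUT

/-- `i → j ≼_L r → s` if `r ≤ i` and `j = s`. -/
def LeL {n : ℕ} (e f : Fin n × Fin n) : Prop := f.1 ≤ e.1 ∧ e.2 = f.2

/-- `i → j ≼_R r → s` if `i = r` and `j ≤ s`. -/
def LeR {n : ℕ} (e f : Fin n × Fin n) : Prop := e.1 = f.1 ∧ e.2 ≤ f.2

/-- `i → j ≼ r → s` if `r ≤ i < j ≤ s`. -/
def LeNest {n : ℕ} (e f : Fin n × Fin n) : Prop := f.1 ≤ e.1 ∧ e.1 < e.2 ∧ e.2 ≤ f.2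

/-- The height `j - i` of an edge `i → j`. -/
def ht {n : ℕ} (e : Fin n × Fin n) : ℤ := ((e.2 : ℕ) : ℤ) - ((e.1 : ℕ) : ℤ)

/-- A set partition of the vertex set, as a set of edges: an antichain for both `≼_L` and `≼_R`. -/
structure IsSetPartition {n : ℕ} (A : Finset (Fin n × Fin n)) : Prop where
  increasing : ∀ e ∈ A, e.1 < e.2
  antichainL : IsAntichain LeL (A : Set (Fin n × Fin n))
  antichainR : IsAntichain LeR (A : Set (Fin n × Fin n))

/-- A nonnesting set partition. -/
structure IsNonnesting {n : ℕ} (A : Finset (Fin n × Fin n)) : Prop extends IsSetPartition A where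
  antichain : IsAntichain LeNest (A : Set (Fin n × Fin n))

/-- The set of edges which lie above some `e ∈ A` and have height at least `ht e + ℓ`. -/
def up {n : ℕ} (A : Finset (Fin n × Fin n)) (ℓ : ℕ) : Set (Fin n × Fin n) :=
  {f | f.1 < f.2 ∧ ∃ e ∈ A, LeNest e f ∧ ht e + ℓ ≤ ht f}

/-! ### Tight splices -/

/-- `lam ⊔ nu` is a splice of `lam`, with set of vertical edges `nu`. -/
structure IsSplice {n : ℕ} (lam nu : Finset (Fin n × Fin n)) : Prop where
  lam_partition : IsSetPartition lam
  nu_partition : IsSetPartition nu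
  disjoint : Disjoint lam nu
  s1 : ∀ i k, (i, k) ∈ nu → ∃ j, i < j ∧ j < k ∧ ((i, j) ∈ lam ∨ (j, k) ∈ lam)
  s2 : ∀ j k, j < k →
    ((∃ i, (i, k) ∈ nu ∧ (i, j) ∈ lam) ↔ (∃ l, (k, l) ∈ lam ∧ (j, l) ∈ nu))

/-- A tight splice `lam ⊔ nu` of a nonnesting set partition `lam`. As `lam` is the set of minimal
elements of `lam ⊔ nu`, recording the pair is the same as recording the union. -/
structure TightSplice (n : ℕ) where
  lam : Finset (Fin n × Fin n)
  nu : Finset (Fin n × Fin n)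
  nonnesting : IsNonnesting lam
  splice : IsSplice lam nu
  tight : ∀ e, e ∈ lam ∨ e ∈ nu → e ∉ up lam 2

/-- The bindings of a splice: edges `i → j`, `k → l` of `lam` joined by vertical edges
`i → k`, `j → l` of `nu`, with `j < k`. -/
structure Binding {n : ℕ} (S : TightSplice n) where
  i : Fin n
  j : Fin n
  k : Fin n
  l : Fin n
  top : (i, j) ∈ S.lam
  bottom : (k, l) ∈ S.lam
  left : (i, k) ∈ S.nu
  right : (j, l) ∈ S.nu
  lt : j < k

instance {n : ℕ} (S : TightSplice n) : Finite (Binding S) :=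
  Finite.of_injective (fun b : Binding S => (b.i, b.j, b.k, b.l)) (by
    rintro ⟨⟩ ⟨⟩ h
    simp only [Prod.mk.injEq] at h
    obtain ⟨rfl, rfl, rfl, rfl⟩ := h
    rfl)

noncomputable instance {n : ℕ} (S : TightSplice n) : Fintype (Binding S) := Fintype.ofFinite _

/-! ### Columns and rows -/

/-- The two edges of `lam` in a binding. -/
def ColStep {n : ℕ} (S : TightSplice n) (e f : {e // e ∈ S.lam}) : Prop :=
  ∃ b : Binding S, e.1 = (b.i, b.j) ∧ f.1 = (b.k, b.l)

/-- The two edges of `nu` in a binding. -/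
def RowStep {n : ℕ} (S : TightSplice n) (e f : {e // e ∈ S.nu}) : Prop :=
  ∃ b : Binding S, e.1 = (b.i, b.k) ∧ f.1 = (b.j, b.l)

/-- The columns: classes of `lam` under the equivalence relation generated by `ColStep`. -/
abbrev Col {n : ℕ} (S : TightSplice n) : Type := Quot (ColStep S)

/-- The rows: classes of `nu` under the equivalence relation generated by `RowStep`. -/
abbrev Row {n : ℕ} (S : TightSplice n) : Type := Quot (RowStep S)

/-- The disjoint union of the sets of columns and of rows. -/
inductive CR {n : ℕ} (S : TightSplice n) : Type where
  | col (C : Col S) : CR S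
  | row (R : Row S) : CR S

/-- The set of edges in a column or row. -/
def CR.edges {n : ℕ} {S : TightSplice n} : CR S → Set (Fin n × Fin n)
  | .col C => {e | ∃ h : e ∈ S.lam, Quot.mk (ColStep S) ⟨e, h⟩ = C}
  | .row R => {e | ∃ h : e ∈ S.nu, Quot.mk (RowStep S) ⟨e, h⟩ = R}

/-- The least left endpoint of an edge of a column or row. -/
noncomputable def CR.minLeft {n : ℕ} {S : TightSplice n} (X : CR S) : ℕ :=
  sInf {m : ℕ | ∃ e ∈ X.edges, m = (e.1 : ℕ)}

/-- The graph of a splice. -/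
def TightSplice.graph {n : ℕ} (S : TightSplice n) : SimpleGraph (Fin n) :=
  SimpleGraph.fromRel (fun a b => (a, b) ∈ S.lam ∨ (a, b) ∈ S.nu)

/-- The least vertex of the connected component of the graph which contains a given column or
row. -/
noncomputable def CR.minComp {n : ℕ} {S : TightSplice n} (X : CR S) : ℕ :=
  sInf {m : ℕ | ∃ e ∈ X.edges, ∃ v : Fin n, S.graph.Reachable e.1 v ∧ m = (v : ℕ)}

/-- `0` for a column, `1` for a row. -/
def CR.kind {n : ℕ} {S : TightSplice n} : CR S → ℕ
  | .col _ => 0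
  | .row _ => 1

/-- Columns precede rows; then the connected components are taken one after the other, by their
least vertex; within a component, columns from left to right and rows from top to bottom, which is
by increasing least left endpoint. -/
noncomputable def CR.key {n : ℕ} {S : TightSplice n} (X : CR S) : ℕ ×ₗ (ℕ ×ₗ ℕ) :=
  toLex (X.kind, toLex (X.minComp, X.minLeft))

theorem CR.edges_nonempty {n : ℕ} {S : TightSplice n} (X : CR S) : X.edges.Nonempty := by
  rcases X with C | R
  · obtain ⟨⟨e, h⟩, rfl⟩ := Quot.exists_rep C
    exact ⟨e, h, rfl⟩
  · obtain ⟨⟨e, h⟩, rfl⟩ := Quot.exists_rep R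
    exact ⟨e, h, rfl⟩

theorem CR.exists_minLeft {n : ℕ} {S : TightSplice n} (X : CR S) :
    ∃ e ∈ X.edges, X.minLeft = (e.1 : ℕ) := by
  obtain ⟨e, he⟩ := X.edges_nonempty
  exact Nat.sInf_mem (s := {m : ℕ | ∃ e ∈ X.edges, m = (e.1 : ℕ)}) ⟨_, e, he, rfl⟩

theorem IsSetPartition.eq_of_fst {n : ℕ} {A : Finset (Fin n × Fin n)} (hA : IsSetPartition A)
    {e f : Fin n × Fin n} (he : e ∈ A) (hf : f ∈ A) (h : e.1 = f.1) : e = f := by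
  rcases le_total e.2 f.2 with h2 | h2
  · exact hA.antichainR.eq he hf ⟨h, h2⟩
  · exact (hA.antichainR.eq hf he ⟨h.symm, h2⟩).symm

theorem CR.key_injective {n : ℕ} {S : TightSplice n} :
    Function.Injective (CR.key : CR S → ℕ ×ₗ (ℕ ×ₗ ℕ)) := by
  intro X Y h
  have h1 : X.kind = Y.kind := congrArg (fun t => (ofLex t).1) h
  have h2 : X.minLeft = Y.minLeft := congrArg (fun t => (ofLex (ofLex t).2).2) h
  obtain ⟨e, he, hX⟩ := X.exists_minLeft
  obtain ⟨f, hf, hY⟩ := Y.exists_minLeft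
  have hef : e.1 = f.1 := Fin.ext (by rw [← hX, ← hY, h2])
  rcases X with C | R <;> rcases Y with C' | R'
  · obtain ⟨he, rfl⟩ := he
    obtain ⟨hf, rfl⟩ := hf
    obtain rfl := S.splice.lam_partition.eq_of_fst he hf hef
    rfl
  · simp [CR.kind] at h1
  · simp [CR.kind] at h1
  · obtain ⟨he, rfl⟩ := he
    obtain ⟨hf, rfl⟩ := hf
    obtain rfl := S.splice.nu_partition.eq_of_fst he hf hef
    rfl

/-- The canonical total order on the set of columns and rows. -/
noncomputable instance {n : ℕ} (S : TightSplice n) : LinearOrder (CR S) :=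
  LinearOrder.lift' CR.key CR.key_injective

instance {n : ℕ} (S : TightSplice n) : Finite (CR S) :=
  Finite.of_surjective (Sum.elim CR.col CR.row : Col S ⊕ Row S → CR S) (by
    rintro (C | R)
    · exact ⟨Sum.inl C, rfl⟩
    · exact ⟨Sum.inr R, rfl⟩)

noncomputable instance {n : ℕ} (S : TightSplice n) : Fintype (CR S) := Fintype.ofFinite _

/-! ### Labeled loopless binary matroids on a totally ordered set -/

/-- The graph model of a loopless binary matroid on `K`: a bipartite graph with parts `U`, `V`,
`U ⊔ V = K`, and edges `E ⊆ U × V`, such that each `v ∈ V` is on an edge and `u < v` for each edge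
`(u, v)`. -/
structure MatroidGraph (K : Type*) [LinearOrder K] where
  U : Finset K
  V : Finset K
  E : Finset (K × K)
  disjoint : Disjoint U V
  cover : ∀ x, x ∈ U ∨ x ∈ V
  edge_mem : ∀ u v, (u, v) ∈ E → u ∈ U ∧ v ∈ V
  exists_edge : ∀ v ∈ V, ∃ u, (u, v) ∈ E
  edge_lt : ∀ u v, (u, v) ∈ E → u < v

/-- A loopless binary matroid with an `Fˣ`-labeling `τ`. -/
structure LabeledMatroid (F : Type*) [Field F] (K : Type*) [LinearOrder K] where
  M : MatroidGraph K
  τ : {e // e ∈ M.E} → Fˣ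

/-- A tight splice with an `Fˣ`-labeling `σ`. -/
structure LabeledSplice (F : Type*) [Field F] (n : ℕ) where
  S : TightSplice n
  σ : Binding S → Fˣ

/-! ### The subspaces attached to the combinatorial data -/

section ideals

variable {F : Type*} [Field F] {n : ℕ}

/-- The subspace spanned by the `e_{r,s}` with `r → s` above `lam` but not in the splice, and the
`e_{i,k} - σ(b) e_{j,l}` for each binding `b`. -/
def idealD (T : LabeledSplice F n) : Submodule F (Matrix (Fin n) (Fin n) F) :=
  Submodule.span F
    ({a | ∃ e ∈ up T.S.lam 0, e ∉ T.S.lam ∧ e ∉ T.S.nu ∧ a = Matrix.single e.1 e.2 1} ∪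
      Set.range (fun b : Binding T.S =>
        Matrix.single b.i b.k (1 : F) - (T.σ b : F) • Matrix.single b.j b.l (1 : F)))

open Classical in
/-- The matrix `b_C` of a column `C`: its entry at `i → j` in `C` is the product of the labels of
the bindings in `C` lying above `i → j`. The matrix `b_R` of a row `R`: the matrix unit at the
`i → j` in `R` with `i` minimal. -/
noncomputable def basisVec (T : LabeledSplice F n) : CR T.S → Matrix (Fin n) (Fin n) F
  | .col C => ∑ e : Fin n × Fin n with e ∈ (CR.col C).edges,
      (∏ b : Binding T.S with (b.i, b.j) ∈ (CR.col C).edges ∧ (b.k, b.l) ∈ (CR.col C).edges ∧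
          b.k ≤ e.1, (T.σ b : F)) • Matrix.single e.1 e.2 (1 : F)
  | .row R => ∑ e : Fin n × Fin n with
      e ∈ (CR.row R).edges ∧ (e.1 : ℕ) = (CR.row R).minLeft, Matrix.single e.1 e.2 (1 : F)

open Classical in
/-- `b_X + ∑ τ(X, Y) b_Y`, the sum being over the edges `(X, Y)` of the matroid. -/
noncomputable def genVec (T : LabeledSplice F n) (Q : LabeledMatroid F (CR T.S)) (X : CR T.S) :
    Matrix (Fin n) (Fin n) F :=
  basisVec T X + ∑ e : {e // e ∈ Q.M.E} with e.1.1 = X, (Q.τ e : F) • basisVec T e.1.2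

/-- The subspace determined by a labeled tight splice and a labeled loopless binary matroid on its
set of columns and rows. -/
noncomputable def idealN (T : LabeledSplice F n) (Q : LabeledMatroid F (CR T.S)) :
    Submodule F (Matrix (Fin n) (Fin n) F) :=
  Submodule.span F {a | ∃ X ∈ Q.M.U,
    ((∃ Y ∈ Q.M.V, (X, Y) ∈ Q.M.E) ∨ ∃ C, X = CR.col C) ∧ a = genVec T Q X} ⊔ idealD T

end ideals

/-! ### The unipotent upper triangular group -/

/-- Upper triangular with ones on the diagonal. -/
def IsUnitri {F : Type*} [Field F] {n : ℕ} (a : Matrix (Fin n) (Fin n) F) : Prop :=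
  (∀ i j, j < i → a i j = 0) ∧ ∀ i, a i i = 1

theorem mul_diag_of_upper {F : Type*} [Field F] {n : ℕ} {a b : Matrix (Fin n) (Fin n) F}
    (ha : ∀ i j, j < i → a i j = 0) (hb : ∀ i j, j < i → b i j = 0) (i : Fin n) :
    (a * b) i i = a i i * b i i := by
  rw [Matrix.mul_apply]
  refine Finset.sum_eq_single i (fun k _ hk => ?_) (by simp)
  rcases lt_or_gt_of_ne hk with h | h
  · rw [ha i k h, zero_mul]
  · rw [hb k i h, mul_zero]

/-- The group of unipotent upper triangular `n × n` matrices over `F`. -/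
def UT (n : ℕ) (F : Type*) [Field F] : Subgroup (Matrix.GeneralLinearGroup (Fin n) F) where
  carrier := {g | IsUnitri (g : Matrix (Fin n) (Fin n) F)}
  one_mem' := ⟨fun i j h => by simp [h.ne'], fun i => by simp⟩
  mul_mem' := by
    rintro g h ⟨hg, hg1⟩ ⟨hh, hh1⟩
    refine ⟨fun i j hij => ?_, fun i => ?_⟩
    · exact Matrix.BlockTriangular.mul (b := id) (M := (g : Matrix (Fin n) (Fin n) F))
        (N := (h : Matrix (Fin n) (Fin n) F)) (fun i j hij => hg i j hij)
        (fun i j hij => hh i j hij) hij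
    · rw [Units.val_mul, mul_diag_of_upper hg hh, hg1, hh1, one_mul]
  inv_mem' := by
    rintro g ⟨hg, hg1⟩
    have hinv : ∀ i j, j < i → ((g⁻¹ : Matrix.GeneralLinearGroup (Fin n) F) :
        Matrix (Fin n) (Fin n) F) i j = 0 := by
      intro i j hij
      rw [Matrix.coe_units_inv]
      have : Invertible (g : Matrix (Fin n) (Fin n) F) := g.invertible
      exact Matrix.blockTriangular_inv_of_blockTriangular (b := id)
        (M := (g : Matrix (Fin n) (Fin n) F)) (fun i j hij => hg i j hij) hij
    refine ⟨hinv, fun i => ?_⟩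
    have h := mul_diag_of_upper hg hinv i
    rw [hg1, one_mul, Units.mul_inv, Matrix.one_apply_eq] at h
    exact h.symm

/-- The subset of the matrix space formed by the elements of a subgroup of `UT n F`. -/
def matrices {F : Type*} [Field F] {n : ℕ} (N : Subgroup (UT n F)) :
    Set (Matrix (Fin n) (Fin n) F) :=
  {a | ∃ g ∈ N, a = ((g : Matrix.GeneralLinearGroup (Fin n) F) : Matrix (Fin n) (Fin n) F)}

end SpliceUT

/-! The two sides are linked by the subspaces `A` with `Adapted lam A A`: supported above a
nonnesting `lam`, not vanishing identically at any position of `lam`, containing `level F lam 2`,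
and stable under commutators with strictly upper triangular matrices. Here `level F lam ℓ` is the
filtration by height above `lam`; multiplying by a strictly upper triangular matrix raises `ℓ` by
one.

Normal subgroups are the sets `1 + A`. For `N` normal, let `lam` be the minimal positions of nonzero
entries in `N - 1`. Double group commutators and descending induction on `ℓ` give `level F lam 2 ⊆ N
- 1` (`level_le_shifted`). Modulo that level, a product of two elements of `N - 1` is a combination
of `e_{i,i+2}` with `i → i+1 → i+2` both in `lam`, and these matrix units already come from
commutators (`Adapted.mul_mem`). Hence `N - 1` is closed under addition, and over a prime field it
is a subspace. `Adapted.exists_normal` is the converse.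

Adapted subspaces are the `idealN`. Modulo level 2 only the commutators `[e_{j,k}, a]` with `k = j +
1` matter, and each has at most two leading terms, `a_{k,l} e_{j,l} - a_{i,j} e_{i,k}` with `i → j`
and `k → l` in `lam`. Let `nu` be the positions above `lam`, outside it, whose matrix units are
missing from `A`. If one of the two units is missing then so is the other, which is (S2); and then a
single constant `σ` satisfies `a_{k,l} = σ a_{i,j}` on all of `A`, with `e_{i,k} - σ e_{j,l}` in `A`
(`Adapted.exists_label`). So `σ` ties together the entries along a column and the matrix units along
a row, and `A` is `idealD` plus a copy of a space `W` of functions on columns and rows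
(`sub_comb_coord_mem_idealD`).

The only conditions on `W` are that no column coordinate vanishes identically and that no unit
vector of a row lies in `W`. The matroid records the reduced echelon form of `W`: `U` holds the
pivots and the identically zero coordinates, `V` the rest. An isolated vertex of `U` could mean
either a unit vector in `W` or a zero coordinate; the conditions force the former for columns and
the latter for rows, so nothing is lost (`LabeledMatroid.space_injective`,
`LabeledMatroid.exists_space_eq`). -/

namespace SpliceUT

/-! ### Reduced echelon forms -/

section echelon

variable {F : Type*} [Field F] {K : Type*} [LinearOrder K]

/-- The label of a pair, extended by `0` to the pairs which are not edges. -/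
def LabeledMatroid.weight (Q : LabeledMatroid F K) (x y : K) : F :=
  if h : (x, y) ∈ Q.M.E then (Q.τ ⟨(x, y), h⟩ : F) else 0

theorem LabeledMatroid.weight_of_mem (Q : LabeledMatroid F K) {x y : K} (h : (x, y) ∈ Q.M.E) :
    Q.weight x y = (Q.τ ⟨(x, y), h⟩ : F) := dif_pos h

theorem LabeledMatroid.weight_ne_zero_iff (Q : LabeledMatroid F K) {x y : K} :
    Q.weight x y ≠ 0 ↔ (x, y) ∈ Q.M.E := by
  unfold LabeledMatroid.weight
  split_ifs with h <;> simp [h]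

theorem LabeledMatroid.weight_eq_zero (Q : LabeledMatroid F K) {x y : K} (h : (x, y) ∉ Q.M.E) :
    Q.weight x y = 0 := dif_neg h

theorem MatroidGraph.mem_V_iff (M : MatroidGraph K) {x : K} : x ∈ M.V ↔ x ∉ M.U :=
  ⟨fun h h' => Finset.disjoint_left.1 M.disjoint h' h, fun h => (M.cover x).resolve_left h⟩

theorem LabeledMatroid.eq_of_weight {Q Q' : LabeledMatroid F K} (hU : Q.M.U = Q'.M.U)
    (hw : ∀ x y, Q.weight x y = Q'.weight x y) : Q = Q' := by
  have hV : Q.M.V = Q'.M.V := by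
    ext x
    rw [MatroidGraph.mem_V_iff, MatroidGraph.mem_V_iff, hU]
  have hE : Q.M.E = Q'.M.E := by
    ext ⟨x, y⟩
    rw [← LabeledMatroid.weight_ne_zero_iff, ← LabeledMatroid.weight_ne_zero_iff, hw]
  obtain ⟨⟨U, V, E, _, _, _, _, _⟩, τ⟩ := Q
  obtain ⟨⟨U', V', E', _, _, _, _, _⟩, τ'⟩ := Q'
  dsimp only at hU hV hE
  subst hU hV hE
  congr
  ext ⟨⟨x, y⟩, h⟩
  have := hw x y
  rwa [LabeledMatroid.weight_of_mem _ h, LabeledMatroid.weight_of_mem _ h] at this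

/-- The vector `e_x + ∑ τ(x, y) e_y`. -/
def LabeledMatroid.rowVec (Q : LabeledMatroid F K) (x : K) : K → F :=
  Pi.single x 1 + Q.weight x

/-- A vertex of `U` which lies on an edge or satisfies `c`. -/
def MatroidGraph.IsActive (M : MatroidGraph K) (c : K → Prop) (x : K) : Prop :=
  x ∈ M.U ∧ ((∃ y ∈ M.V, (x, y) ∈ M.E) ∨ c x)

/-- The span of the vectors of the active vertices. -/
def LabeledMatroid.space (Q : LabeledMatroid F K) (c : K → Prop) : Submodule F (K → F) :=
  Submodule.span F {w | ∃ x, Q.M.IsActive c x ∧ w = Q.rowVec x}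

theorem MatroidGraph.isActive_of_edge (M : MatroidGraph K) (c : K → Prop) {x y : K}
    (h : (x, y) ∈ M.E) : M.IsActive c x :=
  ⟨(M.edge_mem x y h).1, Or.inl ⟨y, (M.edge_mem x y h).2, h⟩⟩

theorem LabeledMatroid.rowVec_apply_of_mem_U (Q : LabeledMatroid F K) (x : K) {y : K}
    (hy : y ∈ Q.M.U) : Q.rowVec x y = (Pi.single x 1 : K → F) y := by
  have h : (x, y) ∉ Q.M.E := fun h => Q.M.mem_V_iff.1 (Q.M.edge_mem x y h).2 hy
  simp [LabeledMatroid.rowVec, Q.weight_eq_zero h]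

theorem LabeledMatroid.rowVec_apply_of_mem_V (Q : LabeledMatroid F K) {x y : K}
    (hx : x ∈ Q.M.U) (hy : y ∈ Q.M.V) : Q.rowVec x y = Q.weight x y := by
  have h : y ≠ x := by rintro rfl; exact Q.M.mem_V_iff.1 hy hx
  simp [LabeledMatroid.rowVec, h]

theorem LabeledMatroid.rowVec_mem_space (Q : LabeledMatroid F K) {c : K → Prop} {x : K}
    (hx : Q.M.IsActive c x) : Q.rowVec x ∈ Q.space c :=
  Submodule.subset_span ⟨x, hx, rfl⟩

theorem LabeledMatroid.sum_weight_mul_single [Fintype K] (Q : LabeledMatroid F K) (x y : K) :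
    ∑ z, Q.weight z y * (Pi.single x 1 : K → F) z = Q.weight x y := by
  rw [Finset.sum_eq_single x] <;> simp +contextual

/-- The generators are in reduced form: restricted to `U` they are unit vectors. So a vector of the
space is determined by its `U`-coordinates, and the edges give its `V`-coordinates. -/
theorem LabeledMatroid.mem_space_iff [Fintype K] (Q : LabeledMatroid F K) (c : K → Prop)
    {w : K → F} : w ∈ Q.space c ↔
      (∀ y ∈ Q.M.V, w y = ∑ x, Q.weight x y * w x) ∧
        ∀ x ∈ Q.M.U, ¬ Q.M.IsActive c x → w x = 0 := by
  classical
  constructor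
  · intro hw
    induction hw using Submodule.span_induction with
    | mem w hw =>
      obtain ⟨x, hx, rfl⟩ := hw
      refine ⟨fun y hy => ?_, fun y hy hay => ?_⟩
      · rw [Q.rowVec_apply_of_mem_V hx.1 hy, ← Q.sum_weight_mul_single x y]
        refine Finset.sum_congr rfl fun z _ => ?_
        by_cases hz : (z, y) ∈ Q.M.E
        · rw [Q.rowVec_apply_of_mem_U x (Q.M.edge_mem z y hz).1]
        · rw [Q.weight_eq_zero hz, zero_mul, zero_mul]
      · rw [Q.rowVec_apply_of_mem_U x hy, Pi.single_apply, if_neg]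
        rintro rfl
        exact hay hx
    | zero => simp
    | add a b _ _ ha hb =>
      refine ⟨fun y hy => ?_, fun x hx hax => ?_⟩
      · simp only [Pi.add_apply, mul_add, Finset.sum_add_distrib, ← ha.1 y hy, ← hb.1 y hy]
      · simp [ha.2 x hx hax, hb.2 x hx hax]
    | smul r a _ ha =>
      refine ⟨fun y hy => ?_, fun x hx hax => ?_⟩
      · simp only [Pi.smul_apply, smul_eq_mul, mul_left_comm, ← Finset.mul_sum, ← ha.1 y hy]
      · simp [ha.2 x hx hax]
  · rintro ⟨h1, h2⟩
    have key : w = ∑ x, if Q.M.IsActive c x then w x • Q.rowVec x else 0 := by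
      ext y
      rw [Finset.sum_apply]
      by_cases hy : y ∈ Q.M.U
      · rw [Finset.sum_eq_single y]
        · split_ifs with ha
          · simp [Q.rowVec_apply_of_mem_U y hy]
          · simpa using h2 y hy ha
        · intro x _ hxy
          split_ifs with ha
          · simp [Q.rowVec_apply_of_mem_U x hy, hxy.symm]
          · rfl
        · simp
      · have hy' := Q.M.mem_V_iff.2 hy
        rw [h1 y hy']
        refine Finset.sum_congr rfl fun x _ => ?_
        split_ifs with ha
        · simp [Q.rowVec_apply_of_mem_V ha.1 hy', mul_comm]
        · rw [Q.weight_eq_zero fun h => ha (Q.M.isActive_of_edge c h)]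
          simp
    rw [key]
    refine Submodule.sum_mem _ fun x _ => ?_
    split_ifs with ha
    · exact Submodule.smul_mem _ _ (Q.rowVec_mem_space ha)
    · exact Submodule.zero_mem _

/-- `x` is the position of the first nonzero coordinate of an element of `W`. -/
def IsPivot (W : Submodule F (K → F)) (x : K) : Prop :=
  ∃ w ∈ W, w x ≠ 0 ∧ ∀ y < x, w y = 0

/-- The first nonzero coordinate of a nonzero element would itself be a pivot. -/
theorem eq_zero_of_isPivot [Finite K] {W : Submodule F (K → F)} {w : K → F} (hw : w ∈ W)
    (h : ∀ x, IsPivot W x → w x = 0) : w = 0 := by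
  ext x
  induction x using WellFoundedLT.induction with
  | ind x ih =>
    by_contra hx
    exact hx (h x ⟨w, hw, hx, ih⟩)

/-- Back-substitution: the vectors of the larger pivots are already reduced, so subtracting
multiples of them clears the later pivot coordinates without disturbing the leading one. -/
theorem IsPivot.exists_reduced [Fintype K] {W : Submodule F (K → F)} {x : K}
    (hx : IsPivot W x) : ∃ w ∈ W, w x = 1 ∧ (∀ y < x, w y = 0) ∧
      ∀ y, IsPivot W y → y ≠ x → w y = 0 := by
  classical
  induction x using WellFoundedGT.induction with
  | ind x ih =>
    obtain ⟨w, hw, hwx, hwy⟩ := hx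
    choose! v hvW hv1 hv0 hvp using ih
    set s : Finset K := {y | x < y ∧ IsPivot W y} with hs
    refine ⟨(w x)⁻¹ • (w - ∑ y ∈ s, w y • v y), ?_, ?_, ?_, ?_⟩
    · refine W.smul_mem _ (W.sub_mem hw (W.sum_mem fun y hy => W.smul_mem _ ?_))
      simp only [hs, Finset.mem_filter, Finset.mem_univ, true_and] at hy
      exact hvW y hy.1 hy.2
    · have : ∀ y ∈ s, w y * v y x = 0 := fun y hy => by
        simp only [hs, Finset.mem_filter, Finset.mem_univ, true_and] at hy
        rw [hv0 y hy.1 hy.2 x hy.1, mul_zero]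
      simp [Finset.sum_apply, Finset.sum_eq_zero this, hwx]
    · intro z hz
      have : ∀ y ∈ s, w y * v y z = 0 := fun y hy => by
        simp only [hs, Finset.mem_filter, Finset.mem_univ, true_and] at hy
        rw [hv0 y hy.1 hy.2 z (hz.trans hy.1), mul_zero]
      simp [Finset.sum_apply, Finset.sum_eq_zero this, hwy z hz]
    · intro z hz hzx
      rcases lt_or_gt_of_ne hzx with h | h
      · have : ∀ y ∈ s, w y * v y z = 0 := fun y hy => by
          simp only [hs, Finset.mem_filter, Finset.mem_univ, true_and] at hy
          rw [hv0 y hy.1 hy.2 z (h.trans hy.1), mul_zero]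
        simp [Finset.sum_apply, Finset.sum_eq_zero this, hwy z h]
      · have : ∑ y ∈ s, w y * v y z = w z := by
          rw [Finset.sum_eq_single z]
          · rw [hv1 z h hz, mul_one]
          · intro y hy hyz
            simp only [hs, Finset.mem_filter, Finset.mem_univ, true_and] at hy
            rw [hvp y hy.1 hy.2 z hz hyz.symm, mul_zero]
          · simp [hs, h, hz]
        simp [Finset.sum_apply, this]

theorem LabeledMatroid.isPivot_space_iff [Fintype K] (Q : LabeledMatroid F K) (c : K → Prop)
    {x : K} : IsPivot (Q.space c) x ↔ Q.M.IsActive c x := by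
  constructor
  · rintro ⟨w, hw, hwx, hwy⟩
    rw [Q.mem_space_iff] at hw
    by_contra ha
    rcases Q.M.cover x with hx | hx
    · exact hwx (hw.2 x hx ha)
    · refine hwx ?_
      rw [hw.1 x hx]
      refine Finset.sum_eq_zero fun z _ => ?_
      by_cases hz : (z, x) ∈ Q.M.E
      · rw [hwy z (Q.M.edge_lt z x hz), mul_zero]
      · rw [Q.weight_eq_zero hz, zero_mul]
  · intro hx
    refine ⟨_, Q.rowVec_mem_space hx, ?_, fun y hy => ?_⟩
    · rw [Q.rowVec_apply_of_mem_U x hx.1]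
      simp
    · have h : (x, y) ∉ Q.M.E := fun h => (Q.M.edge_lt x y h).asymm hy
      simp [LabeledMatroid.rowVec, Q.weight_eq_zero h, hy.ne]

theorem LabeledMatroid.exists_mem_space_ne_zero (Q : LabeledMatroid F K)
    (c : K → Prop) {x : K} (hx : x ∈ Q.M.V ∨ c x) : ∃ w ∈ Q.space c, w x ≠ 0 := by
  by_cases hV : x ∈ Q.M.V
  · obtain ⟨u, hu⟩ := Q.M.exists_edge x hV
    refine ⟨_, Q.rowVec_mem_space (Q.M.isActive_of_edge c hu), ?_⟩
    rw [Q.rowVec_apply_of_mem_V (Q.M.edge_mem u x hu).1 hV]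
    exact Q.weight_ne_zero_iff.2 hu
  · have hU := (Q.M.cover x).resolve_right hV
    refine ⟨_, Q.rowVec_mem_space (x := x) ⟨hU, Or.inr (hx.resolve_left hV)⟩, ?_⟩
    rw [Q.rowVec_apply_of_mem_U x hU]
    simp

theorem LabeledMatroid.single_notMem_space [Fintype K] (Q : LabeledMatroid F K) (c : K → Prop)
    {x : K} (hx : ¬ c x) : (Pi.single x 1 : K → F) ∉ Q.space c := by
  intro h
  rw [Q.mem_space_iff] at h
  simp only [Q.sum_weight_mul_single] at h
  rcases Q.M.cover x with hU | hV
  · by_cases ha : Q.M.IsActive c x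
    · obtain ⟨y, hy, hxy⟩ := ha.2.resolve_right hx
      have h1 := h.1 y hy
      rw [Pi.single_apply, if_neg (Q.M.edge_lt x y hxy).ne'] at h1
      exact Q.weight_ne_zero_iff.2 hxy h1.symm
    · simpa using h.2 x hU ha
  · have h1 := h.1 x hV
    rw [Q.weight_eq_zero fun h => (Q.M.edge_lt x x h).ne rfl] at h1
    simp at h1

/-- This recovers the bipartition from the space alone, as needed for injectivity. -/
theorem LabeledMatroid.mem_U_iff [Fintype K] (Q : LabeledMatroid F K) (c : K → Prop) {x : K} :
    x ∈ Q.M.U ↔ IsPivot (Q.space c) x ∨ ∀ w ∈ Q.space c, w x = 0 := by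
  rw [Q.isPivot_space_iff]
  constructor
  · intro hx
    by_cases ha : Q.M.IsActive c x
    · exact Or.inl ha
    · exact Or.inr fun w hw => ((Q.mem_space_iff c).1 hw).2 x hx ha
  · rintro (h | h)
    · exact h.1
    · by_contra hx
      obtain ⟨w, hw, hne⟩ := Q.exists_mem_space_ne_zero c (Or.inl (Q.M.mem_V_iff.2 hx))
      exact hne (h w hw)

theorem LabeledMatroid.space_injective [Fintype K] (c : K → Prop) :
    Function.Injective fun Q : LabeledMatroid F K => Q.space c := by
  intro Q Q' h
  dsimp only at h
  have hact : ∀ x, Q.M.IsActive c x ↔ Q'.M.IsActive c x := fun x => by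
    rw [← Q.isPivot_space_iff, h, Q'.isPivot_space_iff]
  refine LabeledMatroid.eq_of_weight ?_ fun x y => ?_
  · ext x
    rw [Q.mem_U_iff c, Q'.mem_U_iff c, h]
  · by_cases hx : Q.M.IsActive c x
    · have hx' := (hact x).1 hx
      have : Q.rowVec x - Q'.rowVec x = 0 := by
        refine eq_zero_of_isPivot
          ((Q.space c).sub_mem (Q.rowVec_mem_space hx) (h ▸ Q'.rowVec_mem_space hx')) fun z hz => ?_
        rw [Q.isPivot_space_iff] at hz
        rw [Pi.sub_apply, Q.rowVec_apply_of_mem_U x hz.1,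
          Q'.rowVec_apply_of_mem_U x ((hact z).1 hz).1, sub_self]
      simpa [LabeledMatroid.rowVec, sub_eq_zero] using congrFun this y
    · rw [Q.weight_eq_zero fun h => hx (Q.M.isActive_of_edge c h),
        Q'.weight_eq_zero fun h => hx ((hact x).2 (Q'.M.isActive_of_edge c h))]

theorem LabeledMatroid.exists_space_eq [Fintype K] (c : K → Prop) (W : Submodule F (K → F))
    (hc : ∀ x, c x → ∃ w ∈ W, w x ≠ 0) (hr : ∀ x, ¬ c x → (Pi.single x 1 : K → F) ∉ W) :
    ∃ Q : LabeledMatroid F K, Q.space c = W := by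
  classical
  have hred : ∀ x, ∃ v : K → F, IsPivot W x → v ∈ W ∧ v x = 1 ∧ (∀ y < x, v y = 0) ∧
      ∀ y, IsPivot W y → y ≠ x → v y = 0 := fun x => by
    by_cases hx : IsPivot W x
    · obtain ⟨v, h⟩ := hx.exists_reduced
      exact ⟨v, fun _ => h⟩
    · exact ⟨0, fun h => (hx h).elim⟩
  choose v hv using hred
  have hspan : ∀ w ∈ W, w = ∑ x with IsPivot W x, w x • v x := by
    intro w hw
    rw [← sub_eq_zero]
    refine eq_zero_of_isPivot (W := W) (W.sub_mem hw (W.sum_mem fun x hx => W.smul_mem _ ?_)) ?_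
    · exact (hv x (by simpa using hx)).1
    · intro z hz
      rw [Pi.sub_apply, Finset.sum_apply, Finset.sum_eq_single z]
      · simp [(hv z hz).2.1]
      · intro x hx hxz
        simp [(hv x (by simpa using hx)).2.2.2 z hz hxz.symm]
      · simp [hz]
  let U : Finset K := {x | IsPivot W x ∨ ∀ w ∈ W, w x = 0}
  let E : Finset (K × K) := {e | IsPivot W e.1 ∧ e.2 ∉ U ∧ v e.1 e.2 ≠ 0}
  have hE : ∀ x y, (x, y) ∈ E ↔ IsPivot W x ∧ y ∉ U ∧ v x y ≠ 0 := fun x y => by simp [E]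
  have hU : ∀ x, x ∈ U ↔ (IsPivot W x ∨ ∀ w ∈ W, w x = 0) := fun x => by simp [U]
  let M : MatroidGraph K :=
    { U := U
      V := Uᶜ
      E := E
      disjoint := disjoint_compl_right
      cover := fun x => by simpa using em _
      edge_mem := fun x y h => by
        rw [hE] at h
        exact ⟨(hU x).2 (Or.inl h.1), by simpa using h.2.1⟩
      exists_edge := fun y hy => by
        have hy' : y ∉ U := by simpa using hy
        have h := hy'
        rw [hU] at h
        push Not at h
        obtain ⟨-, w, hw, hwy⟩ := h
        -- If `y` is not identically zero on `W`, some reduced vector is nonzero at `y`, and its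
        -- pivot supplies the edge.
        rw [hspan w hw, Finset.sum_apply] at hwy
        obtain ⟨x, hx, hne⟩ := Finset.exists_ne_zero_of_sum_ne_zero hwy
        refine ⟨x, (hE x y).2 ⟨by simpa using hx, hy', fun h0 => hne ?_⟩⟩
        simp [h0]
      edge_lt := fun x y h => by
        rw [hE] at h
        rcases lt_trichotomy x y with hlt | heq | hgt
        · exact hlt
        · exact absurd ((hU y).2 (Or.inl (heq ▸ h.1))) h.2.1
        · exact absurd ((hv x h.1).2.2.1 y hgt) h.2.2 }
  let Q : LabeledMatroid F K := ⟨M, fun e => Units.mk0 (v e.1.1 e.1.2) ((hE _ _).1 e.2).2.2⟩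
  have hrow : ∀ x, IsPivot W x → Q.rowVec x = v x := by
    intro x hx
    ext y
    by_cases hy : y ∈ U
    · rw [Q.rowVec_apply_of_mem_U x hy]
      by_cases hyx : y = x
      · subst hyx
        simp [(hv y hx).2.1]
      · rw [Pi.single_apply, if_neg hyx]
        rcases (hU y).1 hy with h | h
        · exact ((hv x hx).2.2.2 y h hyx).symm
        · exact (h _ (hv x hx).1).symm
    · have hyV : y ∈ Q.M.V := by simpa [Q, M] using hy
      rw [Q.rowVec_apply_of_mem_V ((hU x).2 (Or.inl hx)) hyV]
      by_cases h0 : v x y = 0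
      · rw [h0]
        exact Q.weight_eq_zero fun h => ((hE x y).1 h).2.2 h0
      · exact Q.weight_of_mem ((hE x y).2 ⟨hx, hy, h0⟩)
  -- The two hypotheses decide the isolated vertices: `hc` makes those satisfying `c` pivots, and
  -- `hr` excludes isolated pivots outside `c`.
  have hact : ∀ x, Q.M.IsActive c x ↔ IsPivot W x := by
    intro x
    constructor
    · rintro ⟨h1, ⟨y, -, h2⟩ | h2⟩
      · exact ((hE x y).1 h2).1
      · refine ((hU x).1 h1).resolve_right fun h => ?_
        obtain ⟨w, hw, hne⟩ := hc x h2
        exact hne (h w hw)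
    · intro hx
      refine ⟨(hU x).2 (Or.inl hx), ?_⟩
      by_contra hcon
      push Not at hcon
      refine hr x hcon.2 ?_
      have : (Pi.single x 1 : K → F) = v x := by
        rw [← hrow x hx]
        ext y
        have : Q.weight x y = 0 :=
          Q.weight_eq_zero fun h => hcon.1 y (Q.M.edge_mem x y h).2 h
        simp [LabeledMatroid.rowVec, this]
      rw [this]
      exact (hv x hx).1
  refine ⟨Q, le_antisymm (Submodule.span_le.2 ?_) fun w hw => ?_⟩
  · rintro _ ⟨x, hx, rfl⟩
    rw [hact] at hx
    rw [hrow x hx]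
    exact (hv x hx).1
  · rw [hspan w hw]
    refine Submodule.sum_mem _ fun x hx => Submodule.smul_mem _ _ ?_
    have hx' : IsPivot W x := by simpa using hx
    rw [← hrow x hx']
    exact Q.rowVec_mem_space ((hact x).2 hx')

end echelon

/-! ### Equivalence relations generated by chains -/

section chain

variable {E B κ : Type*} [LinearOrder κ]

/-- The steps `top b → bot b` form a disjoint union of chains along which `key` increases. -/
structure IsChainSystem (R : E → E → Prop) (top bot : B → E) (key : E → κ) : Prop where
  rel_iff : ∀ e f, R e f ↔ ∃ b, e = top b ∧ f = bot b
  top_inj : Function.Injective top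
  bot_inj : Function.Injective bot
  key_inj : Function.Injective key
  key_lt : ∀ b, key (top b) < key (bot b)

open Classical in
/-- The product of the weights of the steps up to `e` in the class of `e`. -/
noncomputable def chainCoeff {F : Type*} [CommMonoid F] [Fintype B] (R : E → E → Prop)
    (bot : B → E) (key : E → κ) (s : B → F) (e : E) : F :=
  ∏ b with Quot.mk R (bot b) = Quot.mk R e ∧ key (bot b) ≤ key e, s b

/-- `m` has the least key in its class. -/
def IsLeastInClass (R : E → E → Prop) (key : E → κ) (m : E) : Prop :=
  ∀ e, Quot.mk R e = Quot.mk R m → key m ≤ key e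

variable {R : E → E → Prop} {top bot : B → E} {key : E → κ}

theorem IsChainSystem.mk_top (h : IsChainSystem R top bot key) (b : B) :
    Quot.mk R (top b) = Quot.mk R (bot b) :=
  Quot.sound ((h.rel_iff _ _).2 ⟨b, rfl, rfl⟩)

/-- Distinct steps share neither their tops nor their bottoms, so the relation is right unique in
both directions and each class is a single chain. -/
theorem IsChainSystem.comparable (h : IsChainSystem R top bot key) {e f : E}
    (hef : Quot.mk R e = Quot.mk R f) :
    Relation.ReflTransGen R e f ∨ Relation.ReflTransGen R f e := by
  have hr : Relator.RightUnique R := by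
    intro a b c hab hac
    obtain ⟨x, rfl, rfl⟩ := (h.rel_iff _ _).1 hab
    obtain ⟨y, hxy, rfl⟩ := (h.rel_iff _ _).1 hac
    rw [h.top_inj hxy]
  have hl : Relator.RightUnique (Function.swap R) := by
    intro a b c hab hac
    obtain ⟨x, rfl, rfl⟩ := (h.rel_iff _ _).1 hab
    obtain ⟨y, rfl, hxy⟩ := (h.rel_iff _ _).1 hac
    rw [h.bot_inj hxy]
  induction Quot.eqvGen_exact hef with
  | rel _ _ h => exact Or.inl (.single h)
  | refl _ => exact Or.inl .refl
  | symm a b hab ih => exact (ih (Quot.eqvGen_sound hab)).symm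
  | trans a b c hab hbc ih1 ih2 =>
    rcases ih1 (Quot.eqvGen_sound hab) with h1 | h1 <;>
      rcases ih2 (Quot.eqvGen_sound hbc) with h2 | h2
    · exact Or.inl (h1.trans h2)
    · have := Relation.ReflTransGen.total_of_right_unique hl h1.swap h2.swap
      exact this.symm.imp Relation.reflTransGen_swap.1 Relation.reflTransGen_swap.1
    · exact Relation.ReflTransGen.total_of_right_unique hr h1 h2
    · exact Or.inr (h2.trans h1)

theorem IsChainSystem.key_le (h : IsChainSystem R top bot key) {e f : E}
    (hef : Relation.ReflTransGen R e f) : key e ≤ key f := by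
  induction hef with
  | refl => exact le_rfl
  | tail _ hbc ih =>
    obtain ⟨x, rfl, rfl⟩ := (h.rel_iff _ _).1 hbc
    exact ih.trans (h.key_lt x).le

/-- The steps counted at `bot b` are those counted at `top b` together with `b` itself. -/
theorem IsChainSystem.chainCoeff_bot {F : Type*} [CommMonoid F] [Fintype B]
    (h : IsChainSystem R top bot key) (s : B → F) (b : B) :
    chainCoeff R bot key s (bot b) = s b * chainCoeff R bot key s (top b) := by
  classical
  unfold chainCoeff
  rw [← Finset.prod_insert (by simp [h.key_lt b])]
  refine Finset.prod_congr ?_ fun _ _ => rfl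
  ext x
  simp only [Finset.mem_filter, Finset.mem_univ, true_and, Finset.mem_insert]
  constructor
  · rintro ⟨h1, h2⟩
    rcases h.comparable h1 with h3 | h3
    · rcases h3.cases_tail with h4 | ⟨y, h4, h5⟩
      · exact Or.inl (h.bot_inj h4.symm)
      · obtain ⟨z, rfl, h6⟩ := (h.rel_iff _ _).1 h5
        rw [h.bot_inj h6]
        exact Or.inr ⟨h1.trans (by rw [h.bot_inj h6, h.mk_top]), h.key_le h4⟩
    · exact Or.inl (h.bot_inj (h.key_inj (le_antisymm h2 (h.key_le h3))))
  · rintro (rfl | ⟨h1, h2⟩)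
    · exact ⟨rfl, le_rfl⟩
    · exact ⟨h1.trans (h.mk_top b), h2.trans (h.key_lt b).le⟩

theorem IsChainSystem.chainCoeff_least {F : Type*} [CommMonoid F] [Fintype B]
    (h : IsChainSystem R top bot key) (s : B → F) {m : E} (hm : IsLeastInClass R key m) :
    chainCoeff R bot key s m = 1 := by
  classical
  refine Finset.prod_eq_one fun b hb => ?_
  simp only [Finset.mem_filter, Finset.mem_univ, true_and] at hb
  exact absurd ((hm (top b) ((h.mk_top b).trans hb.1)).trans_lt (h.key_lt b)) hb.2.not_gt

/-- The relation is propagated down the chain; an element that is not the bottom of a step must be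
the least one. -/
theorem IsChainSystem.eq_chainCoeff_smul {F V : Type*} [CommMonoid F] [MulAction F V] [Fintype B]
    [WellFoundedLT κ] (h : IsChainSystem R top bot key) (s : B → F) (φ : E → V)
    (hφ : ∀ b, φ (bot b) = s b • φ (top b)) {m : E} (hm : IsLeastInClass R key m) (e : E)
    (he : Quot.mk R e = Quot.mk R m) : φ e = chainCoeff R bot key s e • φ m := by
  induction hk : key e using WellFoundedLT.induction generalizing e with
  | ind k ih =>
    subst hk
    by_cases hb : ∃ b, e = bot b
    · obtain ⟨b, rfl⟩ := hb
      rw [hφ, h.chainCoeff_bot, mul_smul,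
        ← ih _ (h.key_lt b) (top b) ((h.mk_top b).trans he) rfl]
    · have hem : e = m := by
        rcases h.comparable he with h1 | h1
        · exact h.key_inj (le_antisymm (h.key_le h1) (hm e he))
        · rcases h1.cases_tail with h2 | ⟨y, -, h3⟩
          · exact h2
          · obtain ⟨b, -, h4⟩ := (h.rel_iff _ _).1 h3
            exact (hb ⟨b, h4⟩).elim
      rw [hem, h.chainCoeff_least s hm, one_smul]

end chain

/-! ### Subspaces of strictly upper triangular matrices -/

section filtration

variable {n : ℕ} {F : Type*} [Field F]

theorem mem_up_iff {A : Finset (Fin n × Fin n)} {ℓ : ℕ} {r s : Fin n} :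
    (r, s) ∈ up A ℓ ↔ r.val < s.val ∧ ∃ i j : Fin n, (i, j) ∈ A ∧ r.val ≤ i.val ∧
      i.val < j.val ∧ j.val ≤ s.val ∧ j.val + r.val + ℓ ≤ s.val + i.val := by
  simp only [up, LeNest, ht, Set.mem_ofPred_eq, Prod.exists, Fin.lt_def, Fin.le_def]
  refine and_congr_right fun _ => exists_congr fun i => exists_congr fun j =>
    and_congr_right fun _ => ?_
  omega

theorem up_anti (A : Finset (Fin n × Fin n)) {ℓ m : ℕ} (h : m ≤ ℓ) {e : Fin n × Fin n}
    (he : e ∈ up A ℓ) : e ∈ up A m := by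
  obtain ⟨r, s⟩ := e
  rw [mem_up_iff] at he ⊢
  obtain ⟨h1, i, j, h2, h3⟩ := he
  exact ⟨h1, i, j, h2, by omega⟩

theorem mem_up_one {A : Finset (Fin n × Fin n)} {e : Fin n × Fin n}
    (he : e ∈ up A 0) (h : e ∉ A) : e ∈ up A 1 := by
  obtain ⟨r, s⟩ := e
  rw [mem_up_iff] at he ⊢
  obtain ⟨h1, i, j, h2, h3⟩ := he
  refine ⟨h1, i, j, h2, ?_⟩
  by_contra hcon
  have hi : r = i := Fin.ext (by omega)
  have hj : s = j := Fin.ext (by omega)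
  exact h (by rwa [hi, hj])

theorem IsSetPartition.eq_of_snd {A : Finset (Fin n × Fin n)} (hA : IsSetPartition A)
    {e f : Fin n × Fin n} (he : e ∈ A) (hf : f ∈ A) (h : e.2 = f.2) : e = f := by
  rcases le_total f.1 e.1 with h2 | h2
  · exact hA.antichainL.eq he hf ⟨h2, h⟩
  · exact (hA.antichainL.eq hf he ⟨h2, h.symm⟩).symm

theorem IsNonnesting.notMem_up_one {A : Finset (Fin n × Fin n)} (hA : IsNonnesting A)
    {e : Fin n × Fin n} (he : e ∈ A) : e ∉ up A 1 := by
  obtain ⟨r, s⟩ := e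
  rw [mem_up_iff]
  rintro ⟨-, i, j, h2, h3⟩
  have := hA.antichain.eq h2 he ⟨Fin.le_def.2 h3.1, Fin.lt_def.2 h3.2.1, Fin.le_def.2 h3.2.2.1⟩
  simp only [Prod.mk.injEq] at this
  obtain ⟨rfl, rfl⟩ := this
  omega

theorem up_self {A : Finset (Fin n × Fin n)} (hA : IsSetPartition A) {e : Fin n × Fin n}
    (he : e ∈ A) : e ∈ up A 0 := by
  have h := hA.increasing e he
  exact ⟨h, e, he, ⟨le_rfl, h, le_rfl⟩, by simp⟩

/-- The matrices supported on `up A ℓ`. -/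
def level (F : Type*) [Field F] (A : Finset (Fin n × Fin n)) (ℓ : ℕ) :
    Submodule F (Matrix (Fin n) (Fin n) F) where
  carrier := {a | ∀ r s, a r s ≠ 0 → (r, s) ∈ up A ℓ}
  zero_mem' := by simp
  add_mem' := by
    intro a b ha hb r s h
    by_cases h1 : a r s = 0
    · exact hb r s fun h2 => h (by simp [h1, h2])
    · exact ha r s h1
  smul_mem' := by
    intro c a ha r s h
    exact ha r s fun h1 => h (by simp [h1])

/-- The matrices supported on the entries of height at least `m`. -/
def upper (n : ℕ) (F : Type*) [Field F] (m : ℕ) : Submodule F (Matrix (Fin n) (Fin n) F) where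
  carrier := {a | ∀ r s, a r s ≠ 0 → r.val + m ≤ s.val}
  zero_mem' := by simp
  add_mem' := by
    intro a b ha hb r s h
    by_cases h1 : a r s = 0
    · exact hb r s fun h2 => h (by simp [h1, h2])
    · exact ha r s h1
  smul_mem' := by
    intro c a ha r s h
    exact ha r s fun h1 => h (by simp [h1])

theorem single_mem_level {A : Finset (Fin n × Fin n)} {ℓ : ℕ} {r s : Fin n} (c : F)
    (h : (r, s) ∈ up A ℓ) : Matrix.single r s c ∈ level F A ℓ := by
  intro i j hij
  by_cases h1 : r = i ∧ s = j
  · rwa [← h1.1, ← h1.2]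
  · exact absurd (by simp [h1]) hij

theorem single_mem_upper {m : ℕ} {r s : Fin n} (c : F) (h : r.val + m ≤ s.val) :
    Matrix.single r s c ∈ upper n F m := by
  intro i j hij
  by_cases h1 : r = i ∧ s = j
  · rwa [← h1.1, ← h1.2]
  · exact absurd (by simp [h1]) hij

theorem level_anti (A : Finset (Fin n × Fin n)) {ℓ m : ℕ} (h : m ≤ ℓ) :
    level F A ℓ ≤ level F A m := fun _ ha r s hrs => up_anti A h (ha r s hrs)

theorem level_le_upper (A : Finset (Fin n × Fin n)) (ℓ : ℕ) : level F A ℓ ≤ upper n F 1 := by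
  intro a ha r s hrs
  have := (mem_up_iff.1 (ha r s hrs)).1
  omega

theorem exists_of_mul_ne_zero {a b : Matrix (Fin n) (Fin n) F} {r s : Fin n}
    (h : (a * b) r s ≠ 0) : ∃ t, a r t ≠ 0 ∧ b t s ≠ 0 := by
  rw [Matrix.mul_apply] at h
  obtain ⟨t, -, ht⟩ := Finset.exists_ne_zero_of_sum_ne_zero h
  exact ⟨t, left_ne_zero_of_mul ht, right_ne_zero_of_mul ht⟩

theorem level_mul {A : Finset (Fin n × Fin n)} {ℓ m : ℕ} {a b : Matrix (Fin n) (Fin n) F}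
    (ha : a ∈ level F A ℓ) (hb : b ∈ upper n F m) : a * b ∈ level F A (ℓ + m) := by
  intro r s h
  obtain ⟨t, h1, h2⟩ := exists_of_mul_ne_zero h
  have h3 := mem_up_iff.1 (ha r t h1)
  have h4 := hb t s h2
  obtain ⟨h5, i, j, h6, h7⟩ := h3
  exact mem_up_iff.2 ⟨by omega, i, j, h6, by omega⟩

theorem mul_level {A : Finset (Fin n × Fin n)} {ℓ m : ℕ} {a b : Matrix (Fin n) (Fin n) F}
    (hb : b ∈ upper n F m) (ha : a ∈ level F A ℓ) : b * a ∈ level F A (ℓ + m) := by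
  intro r s h
  obtain ⟨t, h1, h2⟩ := exists_of_mul_ne_zero h
  have h3 := mem_up_iff.1 (ha t s h2)
  have h4 := hb r t h1
  obtain ⟨h5, i, j, h6, h7⟩ := h3
  exact mem_up_iff.2 ⟨by omega, i, j, h6, by omega⟩

theorem comm_mem_level {A : Finset (Fin n × Fin n)} {ℓ m : ℕ} {a b : Matrix (Fin n) (Fin n) F}
    (hb : b ∈ upper n F m) (ha : a ∈ level F A ℓ) : b * a - a * b ∈ level F A (ℓ + m) :=
  Submodule.sub_mem _ (mul_level hb ha) (level_mul ha hb)

theorem level_eq_bot (A : Finset (Fin n × Fin n)) : level F A n = ⊥ := by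
  rw [eq_bot_iff]
  intro a ha
  rw [Submodule.mem_bot]
  ext r s
  by_contra h
  obtain ⟨h1, i, j, h2⟩ := mem_up_iff.1 (ha r s h)
  have := s.2
  omega

/-- Matrices with entries in `up A ℓ` are sums of matrix units in `up A ℓ`. -/
theorem mem_of_level {A : Finset (Fin n × Fin n)} {ℓ : ℕ}
    {P : AddSubmonoid (Matrix (Fin n) (Fin n) F)}
    {a : Matrix (Fin n) (Fin n) F} (ha : a ∈ level F A ℓ)
    (hP : ∀ r s c, (r, s) ∈ up A ℓ → Matrix.single r s c ∈ P) : a ∈ P := by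
  rw [Matrix.matrix_eq_sum_single a]
  refine P.sum_mem fun r _ => P.sum_mem fun s _ => ?_
  by_cases h : a r s = 0
  · rw [h, Matrix.single_zero]
    exact P.zero_mem
  · exact hP r s _ (ha r s h)

/-- The part of `a e_{j,k}` which comes from `A`. -/
def leftPart (A : Finset (Fin n × Fin n)) (a : Matrix (Fin n) (Fin n) F) (j k : Fin n) :
    Matrix (Fin n) (Fin n) F :=
  ∑ i, if (i, j) ∈ A then Matrix.single i k (a i j) else 0

/-- The part of `e_{j,k} a` which comes from `A`. -/
def rightPart (A : Finset (Fin n × Fin n)) (a : Matrix (Fin n) (Fin n) F) (j k : Fin n) :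
    Matrix (Fin n) (Fin n) F :=
  ∑ l, if (k, l) ∈ A then Matrix.single j l (a k l) else 0

theorem leftPart_eq {A : Finset (Fin n × Fin n)} (hA : IsSetPartition A)
    (a : Matrix (Fin n) (Fin n) F) {i j : Fin n} (k : Fin n) (h : (i, j) ∈ A) :
    leftPart A a j k = Matrix.single i k (a i j) := by
  unfold leftPart
  rw [Finset.sum_eq_single i, if_pos h]
  · intro r _ hr
    rw [if_neg]
    intro h1
    exact hr (congrArg Prod.fst (hA.eq_of_snd h1 h rfl))
  · simp

theorem rightPart_eq {A : Finset (Fin n × Fin n)} (hA : IsSetPartition A)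
    (a : Matrix (Fin n) (Fin n) F) {k l : Fin n} (j : Fin n) (h : (k, l) ∈ A) :
    rightPart A a j k = Matrix.single j l (a k l) := by
  unfold rightPart
  rw [Finset.sum_eq_single l, if_pos h]
  · intro r _ hr
    rw [if_neg]
    intro h1
    exact hr (congrArg Prod.snd (hA.eq_of_fst h1 h rfl))
  · simp

theorem leftPart_eq_zero {A : Finset (Fin n × Fin n)} (a : Matrix (Fin n) (Fin n) F)
    {j : Fin n} (k : Fin n) (h : ∀ i, (i, j) ∉ A) : leftPart A a j k = 0 :=
  Finset.sum_eq_zero fun i _ => if_neg (h i)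

theorem rightPart_eq_zero {A : Finset (Fin n × Fin n)} (a : Matrix (Fin n) (Fin n) F)
    (j : Fin n) {k : Fin n} (h : ∀ l, (k, l) ∉ A) : rightPart A a j k = 0 :=
  Finset.sum_eq_zero fun i _ => if_neg (h i)

/-- An entry of `a` outside `A` is already one level up, and the shift by one column brings it to
level 2. -/
theorem mul_single_sub_leftPart {A : Finset (Fin n × Fin n)} {a : Matrix (Fin n) (Fin n) F}
    (ha : a ∈ level F A 0) {j k : Fin n} (hjk : j.val + 1 = k.val) :
    a * Matrix.single j k 1 - leftPart A a j k ∈ level F A 2 := by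
  have hL : leftPart A a j k = (Matrix.of fun r s => if (r, s) ∈ A then a r s else 0) *
      Matrix.single j k 1 := by
    ext r s
    simp only [leftPart, Matrix.sum_apply]
    rw [Finset.sum_eq_single r]
    · by_cases hs : s = k
      · subst hs
        split_ifs with h <;> simp [h]
      · rw [Matrix.mul_single_apply_of_ne _ _ _ _ _ hs]
        split_ifs <;> simp [Ne.symm hs]
    · intro i _ hi
      split_ifs <;> simp [hi]
    · simp
  rw [hL, ← sub_mul]
  intro r s h
  have hs : s = k := by
    by_contra hs
    exact h (Matrix.mul_single_apply_of_ne _ _ _ _ _ hs _)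
  subst hs
  simp only [Matrix.mul_single_apply_same, Matrix.sub_apply, Matrix.of_apply, mul_one] at h
  have h1 : (r, j) ∉ A := fun h1 => h (by simp [h1])
  have h2 : a r j ≠ 0 := fun h2 => h (by simp [h1, h2])
  obtain ⟨h3, i, l, h4, h5⟩ := mem_up_iff.1 (mem_up_one (ha r j h2) h1)
  exact mem_up_iff.2 ⟨by omega, i, l, h4, by omega⟩

theorem single_mul_sub_rightPart {A : Finset (Fin n × Fin n)} {a : Matrix (Fin n) (Fin n) F}
    (ha : a ∈ level F A 0) {j k : Fin n} (hjk : j.val + 1 = k.val) :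
    Matrix.single j k 1 * a - rightPart A a j k ∈ level F A 2 := by
  have hL : rightPart A a j k =
      Matrix.single j k 1 * (Matrix.of fun r s => if (r, s) ∈ A then a r s else 0) := by
    ext r s
    simp only [rightPart, Matrix.sum_apply]
    rw [Finset.sum_eq_single s]
    · by_cases hr : r = j
      · subst hr
        split_ifs with h <;> simp [h]
      · rw [Matrix.single_mul_apply_of_ne _ _ _ _ _ hr]
        split_ifs <;> simp [Ne.symm hr]
    · intro i _ hi
      split_ifs <;> simp [hi]
    · simp
  rw [hL, ← mul_sub]
  intro r s h
  have hr : r = j := by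
    by_contra hr
    exact h (Matrix.single_mul_apply_of_ne _ _ _ _ _ hr _)
  subst hr
  simp only [Matrix.single_mul_apply_same, Matrix.sub_apply, Matrix.of_apply, one_mul] at h
  have h1 : (k, s) ∉ A := fun h1 => h (by simp [h1])
  have h2 : a k s ≠ 0 := fun h2 => h (by simp [h1, h2])
  obtain ⟨h3, i, l, h4, h5⟩ := mem_up_iff.1 (mem_up_one (ha k s h2) h1)
  exact mem_up_iff.2 ⟨by omega, i, l, h4, by omega⟩

theorem comm_single_mem_level {A : Finset (Fin n × Fin n)} {a : Matrix (Fin n) (Fin n) F}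
    (ha : a ∈ level F A 0) {j k : Fin n} (c : F) (hjk : j.val + 2 ≤ k.val) :
    Matrix.single j k c * a - a * Matrix.single j k c ∈ level F A 2 :=
  comm_mem_level (single_mem_upper c hjk) ha

/-- `A` is a set of matrices with set of minimal positions `lam` whose commutators lie in `B`. -/
structure Adapted (lam : Finset (Fin n × Fin n)) (A : Set (Matrix (Fin n) (Fin n) F))
    (B : Submodule F (Matrix (Fin n) (Fin n) F)) : Prop where
  nonnesting : IsNonnesting lam
  supp : ∀ a ∈ A, a ∈ level F lam 0
  hit : ∀ i j, (i, j) ∈ lam → ∃ a ∈ A, a i j ≠ 0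
  level_le : level F lam 2 ≤ B
  comm : ∀ a ∈ A, ∀ b ∈ upper n F 1, b * a - a * b ∈ B

namespace Adapted

variable {lam : Finset (Fin n × Fin n)} {A : Set (Matrix (Fin n) (Fin n) F)}
  {B : Submodule F (Matrix (Fin n) (Fin n) F)}

theorem part_mem (h : Adapted lam A B) {a : Matrix (Fin n) (Fin n) F} (ha : a ∈ A) {j k : Fin n}
    (hjk : j.val + 1 = k.val) : rightPart lam a j k - leftPart lam a j k ∈ B := by
  have h1 := h.comm a ha (Matrix.single j k 1) (single_mem_upper 1 hjk.le)
  have h2 := h.level_le (mul_single_sub_leftPart (h.supp a ha) hjk)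
  have h3 := h.level_le (single_mul_sub_rightPart (h.supp a ha) hjk)
  have h4 := B.add_mem (B.sub_mem h1 h3) h2
  convert h4 using 1
  abel

theorem single_one_mem {c : F} (hc : c ≠ 0) {r s : Fin n} (h : Matrix.single r s c ∈ B) :
    Matrix.single r s 1 ∈ B := by
  have := B.smul_mem c⁻¹ h
  rwa [Matrix.smul_single, smul_eq_mul, inv_mul_cancel₀ hc] at this

theorem single_mem {c : F} {r s : Fin n} (h : Matrix.single r s (1 : F) ∈ B) :
    Matrix.single r s c ∈ B := by
  have := B.smul_mem c h
  rwa [Matrix.smul_single, smul_eq_mul, mul_one] at this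

/-- Commute `e_{i,j}` with an element nonzero at `j → k`. The only other leading term comes from an
edge `r → i`, and it is removed by induction on `i`. -/
theorem single_mem_of_consecutive (h : Adapted lam A B) {i j k : Fin n} (hij : i.val + 1 = j.val)
    (hjk : j.val + 1 = k.val) (h1 : (i, j) ∈ lam) (h2 : (j, k) ∈ lam) :
    Matrix.single i k (1 : F) ∈ B := by
  induction hm : i.val using Nat.strong_induction_on generalizing i j k with
  | _ m ih =>
    subst hm
    obtain ⟨a, ha, hne⟩ := h.hit j k h2
    have h3 := h.part_mem ha hij
    rw [rightPart_eq h.nonnesting.toIsSetPartition a i h2] at h3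
    refine single_one_mem hne ?_
    by_cases h4 : ∃ r, (r, i) ∈ lam
    · obtain ⟨r, hr⟩ := h4
      rw [leftPart_eq h.nonnesting.toIsSetPartition a j hr] at h3
      refine (B.sub_mem_iff_left ?_).1 h3
      refine single_mem ?_
      have hri := Fin.lt_def.1 (h.nonnesting.increasing _ hr)
      dsimp only at hri
      by_cases h5 : r.val + 1 = i.val
      · exact ih r.val (by omega) h5 hij hr h1 rfl
      -- If `r → i` has height at least 2, then `r → j` is at least two levels above `i → j`.
      · exact h.level_le (single_mem_level 1 (mem_up_iff.2 ⟨by omega, i, j, h1, by omega⟩))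
    · push Not at h4
      rwa [leftPart_eq_zero a j h4, sub_zero] at h3

/-- A nonzero entry of the product outside level 2 forces both factors to contribute from edges of
`lam` of height 1. -/
theorem mul_mem (h : Adapted lam A B) {a b : Matrix (Fin n) (Fin n) F} (ha : a ∈ level F lam 0)
    (hb : b ∈ level F lam 0) : a * b ∈ B := by
  rw [Matrix.matrix_eq_sum_single (a * b)]
  refine B.sum_mem fun r _ => B.sum_mem fun s _ => ?_
  by_cases h0 : (a * b) r s = 0
  · rw [h0, Matrix.single_zero]
    exact B.zero_mem
  obtain ⟨t, h1, h2⟩ := exists_of_mul_ne_zero h0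
  by_cases h3 : (r, s) ∈ up lam 2
  · exact h.level_le (single_mem_level _ h3)
  have h4 := mem_up_iff.1 (ha r t h1)
  have h5 := mem_up_iff.1 (hb t s h2)
  rw [mem_up_iff] at h3
  obtain ⟨h6, i, j, h7, h8⟩ := h4
  obtain ⟨h9, k, l, h10, h11⟩ := h5
  have h12 : ¬ (j.val + r.val + 2 ≤ s.val + i.val) := fun h12 =>
    h3 ⟨by omega, i, j, h7, by omega⟩
  have h13 : ¬ (l.val + r.val + 2 ≤ s.val + k.val) := fun h13 =>
    h3 ⟨by omega, k, l, h10, by omega⟩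
  obtain rfl : i = r := Fin.ext (by omega)
  obtain rfl : j = t := Fin.ext (by omega)
  obtain rfl : k = j := Fin.ext (by omega)
  obtain rfl : l = s := Fin.ext (by omega)
  exact single_mem (h.single_mem_of_consecutive (by omega) (by omega) h7 h10)

end Adapted

end filtration

/-! ### Minimal positions -/

section minSupport

variable {n : ℕ} {F : Type*} [Field F]

open Classical in
/-- The minimal positions of nonzero entries of the elements of `A`. -/
noncomputable def minSupport (A : Set (Matrix (Fin n) (Fin n) F)) : Finset (Fin n × Fin n) :=
  {e | (∃ a ∈ A, a e.1 e.2 ≠ 0) ∧ ∀ f, LeNest f e → f ≠ e → ∀ a ∈ A, a f.1 f.2 = 0}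

theorem mem_minSupport {A : Set (Matrix (Fin n) (Fin n) F)} {e : Fin n × Fin n} :
    e ∈ minSupport A ↔
      (∃ a ∈ A, a e.1 e.2 ≠ 0) ∧ ∀ f, LeNest f e → f ≠ e → ∀ a ∈ A, a f.1 f.2 = 0 := by
  simp [minSupport]

theorem nonnesting_minSupport {A : Set (Matrix (Fin n) (Fin n) F)}
    (hA : ∀ a ∈ A, a ∈ upper n F 1) : IsNonnesting (minSupport A) := by
  have h1 : ∀ e ∈ minSupport A, e.1 < e.2 := by
    intro e he
    obtain ⟨⟨a, ha, hne⟩, -⟩ := mem_minSupport.1 he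
    exact Fin.lt_def.2 (hA a ha _ _ hne)
  have h2 : IsAntichain LeNest (minSupport A : Set (Fin n × Fin n)) := by
    intro e he f hf hef hle
    obtain ⟨a, ha, hne⟩ := (mem_minSupport.1 he).1
    exact hne ((mem_minSupport.1 hf).2 e hle hef a ha)
  refine ⟨⟨h1, ?_, ?_⟩, h2⟩
  · intro e he f hf hef hle
    exact h2 he hf hef ⟨hle.1, h1 e he, hle.2.le⟩
  · intro e he f hf hef hle
    exact h2 he hf hef ⟨hle.1.ge, h1 e he, hle.2⟩

/-- Induction on height: a position that is not minimal has a strictly smaller nonzero position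
below it. -/
theorem mem_level_minSupport {A : Set (Matrix (Fin n) (Fin n) F)}
    (hA : ∀ a ∈ A, a ∈ upper n F 1) {a : Matrix (Fin n) (Fin n) F} (ha : a ∈ A) :
    a ∈ level F (minSupport A) 0 := by
  intro r s hrs
  induction hm : s.val - r.val using Nat.strong_induction_on generalizing a r s with
  | _ m ih =>
    subst hm
    have hlt := hA a ha r s hrs
    by_cases h : (r, s) ∈ minSupport A
    · exact up_self (nonnesting_minSupport hA).toIsSetPartition h
    · rw [mem_minSupport] at h
      push Not at h
      obtain ⟨⟨i, j⟩, h1, h2, b, hb, h3⟩ := h ⟨a, ha, hrs⟩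
      obtain ⟨h4, h5, h6⟩ := h1
      rw [Fin.le_def] at h4 h6
      rw [Fin.lt_def] at h5
      dsimp only at h3 h4 h5 h6
      have h7 : ¬ (i.val = r.val ∧ j.val = s.val) := fun h7 =>
        h2 (Prod.ext (Fin.ext h7.1) (Fin.ext h7.2))
      obtain ⟨h8, k, l, h9, h10⟩ := mem_up_iff.1 (ih (j.val - i.val) (by omega) hb i j h3 rfl)
      exact mem_up_iff.2 ⟨by omega, k, l, h9, by omega⟩

/-- Consequently `lam` can be read off from the set. -/
theorem Adapted.eq_minSupport {lam : Finset (Fin n × Fin n)}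
    {A : Set (Matrix (Fin n) (Fin n) F)} {B : Submodule F (Matrix (Fin n) (Fin n) F)}
    (h : Adapted lam A B) : lam = minSupport A := by
  ext ⟨r, s⟩
  rw [mem_minSupport]
  constructor
  · intro hrs
    refine ⟨h.hit r s hrs, fun f hf hne a ha => ?_⟩
    by_contra h0
    have h1 := h.supp a ha _ _ h0
    refine h.nonnesting.notMem_up_one hrs ?_
    obtain ⟨i, j⟩ := f
    obtain ⟨h4, h5, h6⟩ := hf
    rw [Fin.le_def] at h4 h6
    rw [Fin.lt_def] at h5
    dsimp only at h1 h4 h5 h6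
    have h7 : ¬ (i.val = r.val ∧ j.val = s.val) := fun h7 =>
      hne (Prod.ext (Fin.ext h7.1) (Fin.ext h7.2))
    obtain ⟨h8, k, l, h9, h10⟩ := mem_up_iff.1 h1
    exact mem_up_iff.2 ⟨by omega, k, l, h9, by omega⟩
  · rintro ⟨⟨a, ha, h0⟩, hmin⟩
    obtain ⟨h1, i, j, h2, h3, h4, h5, -⟩ := mem_up_iff.1 (h.supp a ha _ _ h0)
    obtain ⟨b, hb, h6⟩ := h.hit i j h2
    by_contra hcon
    refine h6 (hmin (i, j) ⟨h3, h4, h5⟩ ?_ b hb)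
    rintro h7
    exact hcon (h7 ▸ h2)

end minSupport

/-! ### Normal subgroups -/

section group

variable {n : ℕ} {F : Type*} [Field F]

/-- The matrix of an element of the unitriangular group. -/
def mat (g : UT n F) : Matrix (Fin n) (Fin n) F :=
  ((g : Matrix.GeneralLinearGroup (Fin n) F) : Matrix (Fin n) (Fin n) F)

theorem mat_mul (g h : UT n F) : mat (g * h) = mat g * mat h := rfl

theorem mat_one : mat (1 : UT n F) = 1 := rfl

theorem mat_injective : Function.Injective (mat : UT n F → Matrix (Fin n) (Fin n) F) :=
  fun _ _ h => Subtype.ext (Units.ext h)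

theorem mat_sub_one_mem (g : UT n F) : mat g - 1 ∈ upper n F 1 := by
  intro r s h
  have hg : IsUnitri (mat g) := g.2
  by_contra hrs
  refine h ?_
  rcases eq_or_ne r s with rfl | hne
  · simp [hg.2]
  · have : s < r := lt_of_le_of_ne (Fin.le_def.2 (by omega)) hne.symm
    simp [hg.1 r s this, hne]

theorem exists_mat_eq {a : Matrix (Fin n) (Fin n) F} (ha : a ∈ upper n F 1) :
    ∃ g : UT n F, mat g = 1 + a := by
  have h0 : ∀ r s : Fin n, s ≤ r → a r s = 0 := fun r s hrs => by
    by_contra h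
    have h1 := ha r s h
    have h2 := Fin.le_def.1 hrs
    omega
  have h1 : IsUnitri (1 + a) :=
    ⟨fun i j hij => by simp [h0 i j hij.le, hij.ne'], fun i => by simp [h0 i i le_rfl]⟩
  have hdet : (1 + a).det ≠ 0 := by
    rw [Matrix.det_of_isUpperTriangular (fun i j hij => h1.1 i j hij)]
    simp [h1.2]
  exact ⟨⟨Matrix.GeneralLinearGroup.mkOfDetNeZero (1 + a) hdet, h1⟩, rfl⟩

/-- The matrices `g - 1` for `g` in `N`. -/
def shifted (N : Subgroup (UT n F)) : Set (Matrix (Fin n) (Fin n) F) :=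
  {a | ∃ g ∈ N, mat g = 1 + a}

theorem matrices_eq (N : Subgroup (UT n F)) : matrices N = {x | ∃ a ∈ shifted N, x = 1 + a} := by
  ext x
  constructor
  · rintro ⟨g, hg, rfl⟩
    exact ⟨mat g - 1, ⟨g, hg, by simp⟩, by simp [mat]⟩
  · rintro ⟨a, ⟨g, hg, h⟩, rfl⟩
    exact ⟨g, hg, h.symm⟩

theorem shifted_injective :
    Function.Injective (shifted : Subgroup (UT n F) → Set (Matrix (Fin n) (Fin n) F)) := by
  intro N N' h
  ext g
  have key : ∀ M : Subgroup (UT n F), g ∈ M ↔ mat g - 1 ∈ shifted M := fun M =>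
    ⟨fun hg => ⟨g, hg, by simp⟩, fun ⟨x, hx, h⟩ => by
      rw [add_sub_cancel] at h
      rwa [← mat_injective h]⟩
  rw [key, key, h]

variable {N : Subgroup (UT n F)}

theorem shifted_upper {a : Matrix (Fin n) (Fin n) F} (ha : a ∈ shifted N) : a ∈ upper n F 1 := by
  obtain ⟨g, -, h⟩ := ha
  have := mat_sub_one_mem g
  rwa [h, add_sub_cancel_left] at this

theorem zero_mem_shifted : (0 : Matrix (Fin n) (Fin n) F) ∈ shifted N :=
  ⟨1, N.one_mem, by simp [mat_one]⟩

theorem add_add_mul_mem_shifted {a b : Matrix (Fin n) (Fin n) F} (ha : a ∈ shifted N)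
    (hb : b ∈ shifted N) : a + b + a * b ∈ shifted N := by
  obtain ⟨g, hg, hga⟩ := ha
  obtain ⟨h, hh, hhb⟩ := hb
  refine ⟨g * h, N.mul_mem hg hh, ?_⟩
  rw [mat_mul, hga, hhb]
  noncomm_ring

/-- With `x = 1 + a` and `g = 1 + b`, one has `g x = x g + (b a - a b)`; multiplying by `(x g)⁻¹`
expresses the group commutator through the additive one. -/
theorem exists_comm_mem_shifted (hN : N.Normal) {a b : Matrix (Fin n) (Fin n) F}
    (ha : a ∈ shifted N) (hb : b ∈ upper n F 1) :
    ∃ c ∈ upper n F 1, (b * a - a * b) + (b * a - a * b) * c ∈ shifted N := by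
  obtain ⟨x, hx, hxa⟩ := ha
  obtain ⟨g, hgb⟩ := exists_mat_eq hb
  refine ⟨_, mat_sub_one_mem (g⁻¹ * x⁻¹), g * x * (g⁻¹ * x⁻¹), ?_, ?_⟩
  · rw [← mul_assoc]
    exact N.mul_mem (hN.conj_mem x hx g) (N.inv_mem hx)
  · have h1 : (1 + a) * (1 + b) * mat (g⁻¹ * x⁻¹) = 1 := by
      rw [← hxa, ← hgb, ← mat_mul, ← mat_mul, ← mat_one]
      congr 1
      group
    rw [mat_mul, mat_mul, hgb, hxa]
    calc (1 + b) * (1 + a) * mat (g⁻¹ * x⁻¹)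
        = (1 + a) * (1 + b) * mat (g⁻¹ * x⁻¹) + (b * a - a * b) * mat (g⁻¹ * x⁻¹) := by
          noncomm_ring
      _ = _ := by
          rw [h1]
          noncomm_ring

/-- Factor `1 + a + z = x (1 + x⁻¹ z)` with `x = 1 + a`; the term `x⁻¹ z` stays in the same level.
-/
theorem add_mem_shifted_of_level {lam : Finset (Fin n × Fin n)} {ℓ : ℕ}
    (hl : ∀ z ∈ level F lam ℓ, z ∈ shifted N) {a z : Matrix (Fin n) (Fin n) F}
    (ha : a ∈ shifted N) (hz : z ∈ level F lam ℓ) : a + z ∈ shifted N := by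
  obtain ⟨x, hx, hxa⟩ := ha
  have hy : mat x⁻¹ * z ∈ level F lam ℓ := by
    have h1 := mul_level (mat_sub_one_mem x⁻¹) hz
    have h2 := (level F lam ℓ).add_mem hz (level_anti lam (Nat.le_add_right ℓ 1) h1)
    convert h2 using 1
    noncomm_ring
  obtain ⟨y, hyN, hyz⟩ := hl _ hy
  refine ⟨x * y, N.mul_mem hx hyN, ?_⟩
  have h1 : (1 + a) * mat x⁻¹ = 1 := by
    rw [← hxa, ← mat_mul, mul_inv_cancel, mat_one]
  rw [mat_mul, hyz, hxa, mul_add, ← mul_assoc, h1]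
  noncomm_ring

/-- The group commutators differ from the additive ones by terms with one further strictly upper
triangular factor, which lie in level `ℓ + 1` and can be absorbed. -/
theorem double_comm_mem_shifted (hN : N.Normal) {lam : Finset (Fin n × Fin n)} {ℓ m₁ m₂ : ℕ}
    (hsupp : ∀ a ∈ shifted N, a ∈ level F lam 0)
    (hl : ∀ z ∈ level F lam (ℓ + 1), z ∈ shifted N) (h₁ : 1 ≤ m₁) (h₂ : 1 ≤ m₂)
    (hm : m₁ + m₂ = ℓ) {a b₁ b₂ : Matrix (Fin n) (Fin n) F} (ha : a ∈ shifted N)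
    (hb₁ : b₁ ∈ upper n F m₁) (hb₂ : b₂ ∈ upper n F m₂) :
    b₂ * (b₁ * a - a * b₁) - (b₁ * a - a * b₁) * b₂ ∈ shifted N := by
  have hup : ∀ {m : ℕ}, 1 ≤ m → ∀ {b}, b ∈ upper n F m → b ∈ upper n F 1 := fun hm b hb r s h => by
    have := hb r s h
    omega
  obtain ⟨c₁, hc₁, hac₁⟩ := exists_comm_mem_shifted hN ha (hup h₁ hb₁)
  obtain ⟨c₂, hc₂, hac₂⟩ := exists_comm_mem_shifted hN hac₁ (hup h₂ hb₂)
  have hw := comm_mem_level hb₁ (hsupp a ha)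
  set w := b₁ * a - a * b₁
  have hwc := level_mul hw hc₁
  have hv := comm_mem_level hb₂ (level_anti lam (Nat.zero_le _) hw)
  have hvc := comm_mem_level hb₂ hwc
  have hw' : w + w * c₁ ∈ level F lam (0 + m₁) :=
    Submodule.add_mem _ hw (level_anti lam (by omega) hwc)
  have hu := level_mul (comm_mem_level hb₂ hw') hc₂
  have h3 : -(b₂ * (w * c₁) - w * c₁ * b₂) - (b₂ * (w + w * c₁) - (w + w * c₁) * b₂) * c₂ ∈
      level F lam (ℓ + 1) :=
    Submodule.sub_mem _ (Submodule.neg_mem _ (level_anti lam (by omega) hvc))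
      (level_anti lam (by omega) hu)
  convert add_mem_shifted_of_level hl hac₂ h3 using 1
  noncomm_ring

/-- Starting from `a` nonzero at a minimal position below `r → s`, a double commutator isolates
`e_{r,s}` modulo level `ℓ + 1`. A single commutator could leave an unwanted term from the other side
of `a`; the second one kills it. -/
theorem single_mem_shifted (hN : N.Normal) {lam : Finset (Fin n × Fin n)} {ℓ : ℕ}
    (hlam : lam = minSupport (shifted N)) (hℓ : 2 ≤ ℓ)
    (hl : ∀ z ∈ level F lam (ℓ + 1), z ∈ shifted N) {r s : Fin n} (c : F)
    (hrs : (r, s) ∈ up lam ℓ) : Matrix.single r s c ∈ shifted N := by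
  have hsupp : ∀ a ∈ shifted N, a ∈ level F lam 0 := fun a ha =>
    hlam ▸ mem_level_minSupport (fun _ => shifted_upper) ha
  by_cases htop : (r, s) ∈ up lam (ℓ + 1)
  · exact hl _ (single_mem_level c htop)
  obtain ⟨hlt, i, j, hij, hri, hlt', hjs, hle⟩ := mem_up_iff.1 hrs
  have heq : j.val + r.val + ℓ = s.val + i.val := by
    by_contra hne
    exact htop (mem_up_iff.2 ⟨hlt, i, j, hij, hri, hlt', hjs, by omega⟩)
  obtain ⟨⟨a, ha, hne⟩, hmin⟩ := mem_minSupport.1 (hlam ▸ hij)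
  dsimp only at hne
  have hlow : ∀ k l : Fin n, l.val ≤ k.val → a k l = 0 := fun k l hkl => by
    by_contra h
    have := shifted_upper ha k l h
    omega
  suffices h : ∃ m₁ m₂, 1 ≤ m₁ ∧ 1 ≤ m₂ ∧ m₁ + m₂ = ℓ ∧ ∃ b₁ ∈ upper n F m₁, ∃ b₂ ∈ upper n F m₂,
      Matrix.single r s c - (b₂ * (b₁ * a - a * b₁) - (b₁ * a - a * b₁) * b₂) ∈
        level F lam (ℓ + 1) by
    obtain ⟨m₁, m₂, h₁, h₂, hm, b₁, hb₁, b₂, hb₂, h⟩ := h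
    have := add_mem_shifted_of_level hl (double_comm_mem_shifted hN hsupp hl h₁ h₂ hm ha hb₁ hb₂) h
    rwa [add_sub_cancel] at this
  have hexp : ∀ b₁ b₂ : Matrix (Fin n) (Fin n) F,
      b₂ * (b₁ * a - a * b₁) - (b₁ * a - a * b₁) * b₂ =
        b₂ * b₁ * a - b₂ * a * b₁ - b₁ * a * b₂ + a * (b₁ * b₂) := fun b₁ b₂ => by noncomm_ring
  simp only [hexp]
  by_cases hr : r.val < i.val
  · by_cases hs : j.val < s.val
    -- Both ends move: of the four terms only `-b₁ a b₂` survives, whence the sign of the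
    -- coefficient.
    · refine ⟨i - r, s - j, by omega, by omega, by omega, Matrix.single r i (-(c * (a i j)⁻¹)),
        single_mem_upper _ (by omega), Matrix.single j s 1, single_mem_upper _ (by omega), ?_⟩
      have e1 : s ≠ r := by rintro rfl; omega
      have e2 : i ≠ j := by rintro rfl; omega
      rw [Matrix.single_mul_single_of_ne _ _ _ _ e1, Matrix.single_mul_single_of_ne _ _ _ _ e2,
        Matrix.single_mul_mul_single, Matrix.single_mul_mul_single, hlow s r (by omega)]
      simp [hne, ← Matrix.single_add]
    · obtain rfl : j = s := Fin.ext (by omega)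
      -- Only the left end moves. As `ℓ ≥ 2`, `e_{r,i}` factors through `q`, and the only surviving
      -- term is row `i` of `a` moved to row `r`.
      let q : Fin n := ⟨i - 1, by omega⟩
      have hq : q.val + 1 = i.val := by simp only [q]; omega
      refine ⟨1, ℓ - 1, le_rfl, by omega, by omega, Matrix.single q i (c * (a i j)⁻¹),
        single_mem_upper _ (by omega), Matrix.single r q 1, single_mem_upper _ (by omega), ?_⟩
      have e1 : i ≠ r := by rintro rfl; omega
      rw [Matrix.single_mul_single_of_ne _ _ _ _ e1, Matrix.single_mul_single_same,
        Matrix.single_mul_mul_single, Matrix.single_mul_mul_single, hlow q q le_rfl,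
        hlow i r (by omega)]
      simp only [mul_zero, zero_mul, Matrix.single_zero, sub_zero, add_zero, one_mul]
      intro k l hkl
      have hk : k = r := by
        by_contra hk
        exact hkl (by simp [Ne.symm hk, hk])
      subst hk
      by_cases hlj : l = j
      · subst hlj
        exact absurd (by simp [hne]) hkl
      -- Left of column `j`, row `i` vanishes by minimality of `i → j`; right of it the new position
      -- is in level `ℓ + 1`.
      · have h1 : a i l ≠ 0 := fun h1 => hkl (by simp [h1, Ne.symm hlj])
        have h2 := shifted_upper ha i l h1
        have h3 : ¬ l.val ≤ j.val := fun h3 =>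
          h1 (hmin (i, l) ⟨le_rfl, Fin.lt_def.2 (by simp only; omega), Fin.le_def.2 h3⟩
            (fun h => hlj (congrArg Prod.snd h)) a ha)
        exact mem_up_iff.2 ⟨by omega, i, j, hij, by omega⟩
  · obtain rfl : i = r := Fin.ext (by omega)
    -- The mirror case: only the right end moves, and `e_{j,s}` factors through `q`.
    let q : Fin n := ⟨j + 1, by omega⟩
    have hq : q.val = j.val + 1 := rfl
    refine ⟨1, ℓ - 1, le_rfl, by omega, by omega, Matrix.single j q (c * (a i j)⁻¹),
      single_mem_upper _ (by omega), Matrix.single q s 1, single_mem_upper _ (by omega), ?_⟩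
    have e1 : s ≠ j := by rintro rfl; omega
    rw [Matrix.single_mul_single_of_ne _ _ _ _ e1, Matrix.single_mul_single_same,
      Matrix.single_mul_mul_single, Matrix.single_mul_mul_single, hlow q q le_rfl,
      hlow s j (by omega)]
    simp only [mul_zero, zero_mul, Matrix.single_zero, sub_zero, zero_add, mul_one]
    intro k l hkl
    have hk : l = s := by
      by_contra hk
      exact hkl (by simp [Ne.symm hk, hk])
    subst hk
    by_cases hki : k = i
    · subst hki
      exact absurd (by simp [hne, mul_left_comm]) hkl
    · have h1 : a k j ≠ 0 := fun h1 => hkl (by simp [h1, Ne.symm hki])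
      have h2 := shifted_upper ha k j h1
      have h3 : ¬ i.val ≤ k.val := fun h3 =>
        h1 (hmin (k, j) ⟨Fin.le_def.2 h3, Fin.lt_def.2 (by simp only; omega), le_rfl⟩
          (fun h => hki (congrArg Prod.fst h)) a ha)
      exact mem_up_iff.2 ⟨by omega, i, j, hij, by omega⟩

theorem level_le_shifted (hN : N.Normal) {ℓ : ℕ} (hℓ : 2 ≤ ℓ) :
    ∀ z ∈ level F (minSupport (shifted N)) ℓ, z ∈ shifted N := by
  by_cases hn : n ≤ ℓ
  · intro z hz
    have h := level_anti _ hn hz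
    rw [level_eq_bot, Submodule.mem_bot] at h
    rw [h]
    exact zero_mem_shifted
  · induction hk : n - ℓ using Nat.strong_induction_on generalizing ℓ with
    | _ k ih =>
      have hl : ∀ z ∈ level F (minSupport (shifted N)) (ℓ + 1), z ∈ shifted N := by
        by_cases hn' : n ≤ ℓ + 1
        · intro z hz
          have h := level_anti _ hn' hz
          rw [level_eq_bot, Submodule.mem_bot] at h
          rw [h]
          exact zero_mem_shifted
        · exact ih (n - (ℓ + 1)) (by omega) (by omega) hn' rfl
      let P : AddSubmonoid (Matrix (Fin n) (Fin n) F) :=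
        { carrier := {z | z ∈ level F (minSupport (shifted N)) ℓ ∧ z ∈ shifted N}
          zero_mem' := ⟨Submodule.zero_mem _, zero_mem_shifted⟩
          add_mem' := by
            rintro x y ⟨hx, hx'⟩ ⟨hy, hy'⟩
            refine ⟨Submodule.add_mem _ hx hy, ?_⟩
            -- The group law adds an extra `x y`, which is one level deeper and already available by
            -- induction.
            have h := Submodule.neg_mem _ (level_mul hx (shifted_upper hy'))
            convert add_mem_shifted_of_level hl (add_add_mul_mem_shifted hx' hy') h using 1
            abel }
      intro z hz
      exact (mem_of_level (P := P) hz fun r s c hrs =>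
        ⟨single_mem_level c hrs, single_mem_shifted hN rfl hℓ hl c hrs⟩).2

end group

/-! ### Normal subgroups and adapted subspaces over a prime field -/

section prime

variable {n p : ℕ} [Fact p.Prime]

/-- An additive submonoid of a vector space over `ZMod p` is a subspace. -/
def submoduleOfAddSubmonoid {V : Type*} [AddCommGroup V] [Module (ZMod p) V]
    (P : AddSubmonoid V) : Submodule (ZMod p) V :=
  { P with
    smul_mem' := fun c x hx => by
      have h : c • x = c.val • x := by
        rw [← Nat.cast_smul_eq_nsmul (ZMod p), ZMod.natCast_zmod_val]
      rw [h]
      exact P.nsmul_mem hx _ }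

/-- Additivity is obtained in two stages: first for the part `B` of `shifted N` in level 1, where
products fall into level 2, then for all of `shifted N`, whose products fall into `B`. This is why
`Adapted` separates the set from the subspace receiving its commutators. -/
theorem exists_adapted_of_normal {N : Subgroup (UT n (ZMod p))} (hN : N.Normal) :
    ∃ A : Submodule (ZMod p) (Matrix (Fin n) (Fin n) (ZMod p)),
      (A : Set (Matrix (Fin n) (Fin n) (ZMod p))) = shifted N ∧
        Adapted (minSupport (shifted N)) (A : Set (Matrix (Fin n) (Fin n) (ZMod p))) A := by
  set lam := minSupport (shifted N) with hlam
  have hl : ∀ z ∈ level (ZMod p) lam 2, z ∈ shifted N := level_le_shifted hN le_rfl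
  have hsupp : ∀ a ∈ shifted N, a ∈ level (ZMod p) lam 0 := fun a ha =>
    mem_level_minSupport (fun _ => shifted_upper) ha
  let B : Submodule (ZMod p) (Matrix (Fin n) (Fin n) (ZMod p)) := submoduleOfAddSubmonoid
    { carrier := {z | z ∈ level (ZMod p) lam 1 ∧ z ∈ shifted N}
      zero_mem' := ⟨Submodule.zero_mem _, zero_mem_shifted⟩
      add_mem' := by
        rintro x y ⟨hx, hx'⟩ ⟨hy, hy'⟩
        refine ⟨Submodule.add_mem _ hx hy, ?_⟩
        have h := Submodule.neg_mem _ (level_mul hx (shifted_upper hy'))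
        convert add_mem_shifted_of_level hl (add_add_mul_mem_shifted hx' hy') h using 1
        abel }
  have hB : ∀ z, z ∈ B ↔ z ∈ level (ZMod p) lam 1 ∧ z ∈ shifted N := fun z => Iff.rfl
  have hAB : Adapted lam (shifted N) B :=
    { nonnesting := nonnesting_minSupport fun _ => shifted_upper
      supp := hsupp
      hit := fun i j hij => (mem_minSupport.1 hij).1
      level_le := fun z hz => ⟨level_anti lam one_le_two hz, hl z hz⟩
      comm := fun a ha b hb => by
        have h1 := comm_mem_level hb (hsupp a ha)
        refine ⟨h1, ?_⟩
        obtain ⟨c, hc, h⟩ := exists_comm_mem_shifted hN ha hb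
        have h2 := Submodule.neg_mem _ (level_mul h1 hc)
        convert add_mem_shifted_of_level hl h h2 using 1
        abel }
  have hadd : ∀ a ∈ shifted N, ∀ z ∈ B, a + z ∈ shifted N := by
    intro a ha z hz
    rw [hB] at hz
    have h := Submodule.neg_mem _ (mul_level (shifted_upper ha) hz.1)
    convert add_mem_shifted_of_level hl (add_add_mul_mem_shifted ha hz.2) h using 1
    abel
  refine ⟨submoduleOfAddSubmonoid
    { carrier := shifted N
      zero_mem' := zero_mem_shifted
      add_mem' := fun {x y} hx hy => by
        have h := B.neg_mem (hAB.mul_mem (hsupp x hx) (hsupp y hy))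
        convert hadd _ (add_add_mul_mem_shifted hx hy) _ h using 1
        abel }, rfl, ?_⟩
  exact
    { nonnesting := hAB.nonnesting
      supp := hsupp
      hit := hAB.hit
      level_le := fun z hz => hl z hz
      comm := fun a ha b hb => (hAB.comm a ha b hb).2 }

theorem Adapted.exists_normal {lam : Finset (Fin n × Fin n)}
    {A : Submodule (ZMod p) (Matrix (Fin n) (Fin n) (ZMod p))} (h : Adapted lam A A) :
    ∃ N : Subgroup (UT n (ZMod p)), N.Normal ∧ shifted N = A := by
  let P : Submonoid (UT n (ZMod p)) :=
    { carrier := {g | mat g - 1 ∈ A}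
      one_mem' := by simp [mat_one]
      mul_mem' := by
        intro x y hx hy
        change mat (x * y) - 1 ∈ A
        have h1 := A.add_mem (A.add_mem hx hy) (h.mul_mem (h.supp _ hx) (h.supp _ hy))
        convert h1 using 1
        rw [mat_mul]
        noncomm_ring }
  let N : Subgroup (UT n (ZMod p)) :=
    { P with
      inv_mem' := by
        intro x hx
        -- The group is finite, so inverses are powers and closure under products suffices.
        have h1 : x⁻¹ ∈ Submonoid.powers x :=
          (isOfFinOrder_of_finite x).mem_powers_iff_mem_zpowers.2 (Subgroup.inv_mem _
            (Subgroup.mem_zpowers x))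
        exact (Submonoid.powers_le (P := P)).2 hx h1 }
  refine ⟨N, ⟨fun x hx g => ?_⟩, ?_⟩
  · change mat (g * x * g⁻¹) - 1 ∈ A
    have hx' : mat x - 1 ∈ A := hx
    -- Conjugation adds to `x - 1` the commutator of `g - 1` with it, plus that commutator times
    -- `g⁻¹ - 1`; the latter lies in level 2.
    have h1 := h.comm _ hx' _ (mat_sub_one_mem g)
    have hw := comm_mem_level (mat_sub_one_mem g) (h.supp _ hx')
    have hwg := level_mul hw (mat_sub_one_mem g⁻¹)
    have h2 := h.level_le hwg
    have h3 := A.add_mem hx' (A.add_mem h1 h2)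
    convert h3 using 1
    have h4 : mat x * mat g * mat g⁻¹ = mat x := by
      rw [← mat_mul, ← mat_mul, mul_inv_cancel_right]
    rw [mat_mul, mat_mul]
    calc mat g * mat x * mat g⁻¹ - 1
        = mat x * mat g * mat g⁻¹ - 1 + (mat g * mat x - mat x * mat g) * mat g⁻¹ := by
          noncomm_ring
      _ = _ := by
          rw [h4]
          noncomm_ring
  · ext a
    constructor
    · rintro ⟨g, hg, hga⟩
      have hg' : mat g - 1 ∈ A := hg
      rwa [hga, add_sub_cancel_left] at hg'
    · intro ha
      obtain ⟨g, hg⟩ := exists_mat_eq (level_le_upper _ _ (h.supp a ha))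
      refine ⟨g, ?_, hg⟩
      change mat g - 1 ∈ A
      rwa [hg, add_sub_cancel_left]

end prime

/-! ### The chains of edges in columns and rows -/

section splice

variable {n : ℕ}

theorem Binding.ext_fields {S : TightSplice n} {b c : Binding S} (hi : b.i = c.i) (hj : b.j = c.j)
    (hk : b.k = c.k) (hl : b.l = c.l) : b = c := by
  obtain ⟨⟩ := b
  obtain ⟨⟩ := c
  dsimp only at hi hj hk hl
  subst hi hj hk hl
  rfl

theorem IsSetPartition.fst_inj {A : Finset (Fin n × Fin n)} (hA : IsSetPartition A)
    {i j k : Fin n} (h1 : (i, j) ∈ A) (h2 : (i, k) ∈ A) : j = k :=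
  congrArg Prod.snd (hA.eq_of_fst h1 h2 rfl)

theorem IsSetPartition.snd_inj {A : Finset (Fin n × Fin n)} (hA : IsSetPartition A)
    {i j k : Fin n} (h1 : (j, i) ∈ A) (h2 : (k, i) ∈ A) : j = k :=
  congrArg Prod.fst (hA.eq_of_snd h1 h2 rfl)

variable (S : TightSplice n)

/-- In a set partition each vertex starts at most one edge and ends at most one, so either
horizontal edge of a binding determines the other three edges. -/
theorem isChainSystem_col : IsChainSystem (ColStep S)
    (fun b : Binding S => (⟨(b.i, b.j), b.top⟩ : {e // e ∈ S.lam}))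
    (fun b : Binding S => (⟨(b.k, b.l), b.bottom⟩ : {e // e ∈ S.lam})) (fun e => e.1.1) where
  rel_iff e f := by simp only [ColStep, Subtype.ext_iff]
  top_inj := by
    intro b c h
    simp only [Subtype.mk.injEq, Prod.mk.injEq] at h
    have hk := S.splice.nu_partition.fst_inj b.left (h.1 ▸ c.left)
    exact Binding.ext_fields h.1 h.2 hk
      (S.splice.lam_partition.fst_inj b.bottom (hk ▸ c.bottom))
  bot_inj := by
    intro b c h
    simp only [Subtype.mk.injEq, Prod.mk.injEq] at h
    have hi := S.splice.nu_partition.snd_inj b.left (h.1 ▸ c.left)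
    exact Binding.ext_fields hi (S.splice.lam_partition.fst_inj b.top (hi ▸ c.top)) h.1 h.2
  key_inj := fun e f h => Subtype.ext (S.splice.lam_partition.eq_of_fst e.2 f.2 h)
  key_lt b := lt_trans (S.splice.lam_partition.increasing _ b.top) b.lt

theorem isChainSystem_row : IsChainSystem (RowStep S)
    (fun b : Binding S => (⟨(b.i, b.k), b.left⟩ : {e // e ∈ S.nu}))
    (fun b : Binding S => (⟨(b.j, b.l), b.right⟩ : {e // e ∈ S.nu})) (fun e => e.1.1) where
  rel_iff e f := by simp only [RowStep, Subtype.ext_iff]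
  top_inj := by
    intro b c h
    simp only [Subtype.mk.injEq, Prod.mk.injEq] at h
    exact Binding.ext_fields h.1 (S.splice.lam_partition.fst_inj b.top (h.1 ▸ c.top)) h.2
      (S.splice.lam_partition.fst_inj b.bottom (h.2 ▸ c.bottom))
  bot_inj := by
    intro b c h
    simp only [Subtype.mk.injEq, Prod.mk.injEq] at h
    exact Binding.ext_fields (S.splice.lam_partition.snd_inj b.top (h.1 ▸ c.top)) h.1
      (S.splice.lam_partition.snd_inj b.bottom (h.2 ▸ c.bottom)) h.2
  key_inj := fun e f h => Subtype.ext (S.splice.nu_partition.eq_of_fst e.2 f.2 h)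
  key_lt b := S.splice.lam_partition.increasing _ b.top

variable {S}

theorem CR.minLeft_le {X : CR S} {e : Fin n × Fin n} (he : e ∈ X.edges) :
    X.minLeft ≤ (e.1 : ℕ) := Nat.sInf_le ⟨e, he, rfl⟩

theorem exists_colMin (C : Col S) : ∃ m : {e // e ∈ S.lam}, Quot.mk (ColStep S) m = C ∧
    IsLeastInClass (ColStep S) (fun e => e.1.1) m := by
  obtain ⟨m, ⟨h1, h2⟩, h3⟩ := (CR.col C).exists_minLeft
  refine ⟨⟨m, h1⟩, h2, fun e he => Fin.le_def.2 ?_⟩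
  dsimp only
  rw [← h3]
  exact CR.minLeft_le ⟨e.2, he.trans h2⟩

theorem exists_rowMin (R : Row S) : ∃ m : {e // e ∈ S.nu}, Quot.mk (RowStep S) m = R ∧
    (CR.row R).minLeft = (m.1.1 : ℕ) ∧ IsLeastInClass (RowStep S) (fun e => e.1.1) m := by
  obtain ⟨m, ⟨h1, h2⟩, h3⟩ := (CR.row R).exists_minLeft
  refine ⟨⟨m, h1⟩, h2, h3, fun e he => Fin.le_def.2 ?_⟩
  dsimp only
  rw [← h3]
  exact CR.minLeft_le ⟨e.2, he.trans h2⟩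

/-- The edge of a column with the least left endpoint. -/
noncomputable def colMin (C : Col S) : {e // e ∈ S.lam} := (exists_colMin C).choose

/-- The edge of a row with the least left endpoint. -/
noncomputable def rowMin (R : Row S) : {e // e ∈ S.nu} := (exists_rowMin R).choose

theorem mk_colMin (C : Col S) : Quot.mk (ColStep S) (colMin C) = C :=
  (exists_colMin C).choose_spec.1

theorem isLeast_colMin (C : Col S) : IsLeastInClass (ColStep S) (fun e => e.1.1) (colMin C) :=
  (exists_colMin C).choose_spec.2

theorem mk_rowMin (R : Row S) : Quot.mk (RowStep S) (rowMin R) = R :=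
  (exists_rowMin R).choose_spec.1

theorem minLeft_row (R : Row S) : (CR.row R).minLeft = ((rowMin R).1.1 : ℕ) :=
  (exists_rowMin R).choose_spec.2.1

theorem isLeast_rowMin (R : Row S) : IsLeastInClass (RowStep S) (fun e => e.1.1) (rowMin R) :=
  (exists_rowMin R).choose_spec.2.2

theorem TightSplice.notMem_lam {e : Fin n × Fin n} (he : e ∈ S.nu) : e ∉ S.lam :=
  fun h => Finset.disjoint_left.1 S.splice.disjoint h he

theorem TightSplice.nu_subset_up {e : Fin n × Fin n} (he : e ∈ S.nu) : e ∈ up S.lam 0 := by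
  obtain ⟨i, k⟩ := e
  obtain ⟨j, h1, h2, h3 | h3⟩ := S.splice.s1 i k he
  · exact mem_up_iff.2 ⟨by omega, i, j, h3, by omega⟩
  · exact mem_up_iff.2 ⟨by omega, j, k, h3, by omega⟩

end splice

/-! ### Coordinates with respect to columns and rows -/

section coordinates

variable {F : Type*} [Field F] {n : ℕ} (T : LabeledSplice F n)

/-- The coefficient of an edge in the vector of its column. -/
noncomputable def colCoeff (e : {e // e ∈ T.S.lam}) : Fˣ :=
  chainCoeff (ColStep T.S) (fun b : Binding T.S => (⟨(b.k, b.l), b.bottom⟩ : {e // e ∈ T.S.lam}))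
    (fun e => e.1.1) T.σ e

/-- The factor by which the matrix unit of an edge differs from that of the first edge of its row,
modulo `idealD`. -/
noncomputable def rowCoeff (e : {e // e ∈ T.S.nu}) : Fˣ :=
  chainCoeff (RowStep T.S) (fun b : Binding T.S => (⟨(b.j, b.l), b.right⟩ : {e // e ∈ T.S.nu}))
    (fun e => e.1.1) (fun b => (T.σ b)⁻¹) e

theorem basisVec_col_apply (C : Col T.S) (e : {e // e ∈ T.S.lam})
    (he : Quot.mk (ColStep T.S) e = C) :
    basisVec T (.col C) e.1.1 e.1.2 = (colCoeff T e : F) := by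
  classical
  subst he
  simp only [basisVec, Matrix.sum_apply]
  rw [Finset.sum_eq_single e.1]
  · rw [Matrix.smul_apply, Matrix.single_apply_same, smul_eq_mul, mul_one, colCoeff, chainCoeff,
      Units.coe_prod]
    refine Finset.prod_congr ?_ fun _ _ => rfl
    ext b
    rw [Finset.mem_filter, Finset.mem_filter]
    simp only [Finset.mem_univ, true_and]
    constructor
    · rintro ⟨-, ⟨_, h1⟩, h2⟩
      exact ⟨h1, h2⟩
    · rintro ⟨h1, h2⟩
      exact ⟨⟨b.top, ((isChainSystem_col T.S).mk_top b).trans h1⟩, ⟨b.bottom, h1⟩, h2⟩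
  · intro f _ hf
    rw [Matrix.smul_apply, Matrix.single_apply, if_neg, smul_zero]
    rintro ⟨h1, h2⟩
    exact hf (Prod.ext h1 h2)
  · intro h
    exact absurd (Finset.mem_filter.2 ⟨Finset.mem_univ _, e.2, rfl⟩) h

theorem basisVec_col_apply_of_notMem (C : Col T.S) {r s : Fin n}
    (h : (r, s) ∉ (CR.col C).edges) : basisVec T (.col C) r s = 0 := by
  classical
  simp only [basisVec, Matrix.sum_apply]
  refine Finset.sum_eq_zero fun f hf => ?_
  rw [Matrix.smul_apply, Matrix.single_apply, if_neg, smul_zero]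
  rintro ⟨rfl, rfl⟩
  exact h (Finset.mem_filter.1 hf).2

theorem basisVec_row (R : Row T.S) :
    basisVec T (.row R) = Matrix.single (rowMin R).1.1 (rowMin R).1.2 1 := by
  classical
  simp only [basisVec]
  rw [Finset.sum_eq_single (rowMin R).1]
  · intro f hf hne
    obtain ⟨⟨h1, -⟩, h2⟩ := (Finset.mem_filter.1 hf).2
    rw [minLeft_row] at h2
    exact absurd (T.S.splice.nu_partition.eq_of_fst h1 (rowMin R).2 (Fin.ext h2)) hne
  · intro h
    exact absurd (Finset.mem_filter.2
      ⟨Finset.mem_univ _, ⟨(rowMin R).2, mk_rowMin R⟩, (minLeft_row R).symm⟩) h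

open Classical in
/-- The coordinates of a matrix modulo `idealD`. -/
noncomputable def coord : Matrix (Fin n) (Fin n) F →ₗ[F] (CR T.S → F) :=
  LinearMap.pi fun X => match X with
    | .col C => Matrix.entryLinearMap F F (colMin C).1.1 (colMin C).1.2
    | .row R => ∑ f : {e // e ∈ T.S.nu}, if Quot.mk (RowStep T.S) f = R then
        (rowCoeff T f : F) • Matrix.entryLinearMap F F f.1.1 f.1.2 else 0

theorem coord_col (a : Matrix (Fin n) (Fin n) F) (C : Col T.S) :
    coord T a (.col C) = a (colMin C).1.1 (colMin C).1.2 := rfl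

open Classical in
theorem coord_row (a : Matrix (Fin n) (Fin n) F) (R : Row T.S) :
    coord T a (.row R) = ∑ f : {e // e ∈ T.S.nu}, if Quot.mk (RowStep T.S) f = R then
      (rowCoeff T f : F) * a f.1.1 f.1.2 else 0 := by
  simp only [coord, LinearMap.pi_apply, LinearMap.sum_apply]
  refine Finset.sum_congr rfl fun f _ => ?_
  split_ifs <;> simp

theorem coord_row_eq_zero {a : Matrix (Fin n) (Fin n) F}
    (h : ∀ e ∈ T.S.nu, a e.1 e.2 = 0) (R : Row T.S) : coord T a (.row R) = 0 := by
  classical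
  rw [coord_row]
  refine Finset.sum_eq_zero fun f _ => ?_
  rw [h f.1 f.2, mul_zero, ite_self]

theorem coord_single_nu (f : {e // e ∈ T.S.nu}) (c : F) :
    coord T (Matrix.single f.1.1 f.1.2 c) =
      Pi.single (.row (Quot.mk _ f)) ((rowCoeff T f : F) * c) := by
  classical
  ext X
  rcases X with C | R
  · rw [coord_col, Matrix.single_apply, if_neg, Pi.single_apply, if_neg (by simp)]
    rintro ⟨h1, h2⟩
    have h3 : f.1 = (colMin C).1 := Prod.ext h1 h2
    exact T.S.notMem_lam f.2 (h3 ▸ (colMin C).2)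
  · rw [coord_row, Finset.sum_eq_single f]
    · simp [Pi.single_apply, eq_comm]
    · intro g _ hg
      have h0 : Matrix.single f.1.1 f.1.2 c g.1.1 g.1.2 = 0 := by
        rw [Matrix.single_apply, if_neg]
        rintro ⟨h1, h2⟩
        exact hg (Subtype.ext (Prod.ext h1 h2).symm)
      rw [h0, mul_zero, ite_self]
    · simp

theorem coord_basisVec (X : CR T.S) : coord T (basisVec T X) = Pi.single X 1 := by
  classical
  rcases X with C | R
  · ext Y
    rcases Y with C' | R'
    · rw [coord_col]
      by_cases h : C' = C
      · subst h
        rw [basisVec_col_apply T C' (colMin C') (mk_colMin C'), colCoeff,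
          (isChainSystem_col T.S).chainCoeff_least T.σ (isLeast_colMin C')]
        simp
      · rw [basisVec_col_apply_of_notMem, Pi.single_apply, if_neg (by simpa using h)]
        rintro ⟨h1, h2⟩
        exact h ((mk_colMin C').symm.trans h2)
    · rw [coord_row_eq_zero, Pi.single_apply, if_neg (by simp)]
      intro e he
      refine basisVec_col_apply_of_notMem T C ?_
      rintro ⟨h1, -⟩
      exact T.S.notMem_lam he h1
  · rw [basisVec_row, coord_single_nu, mk_rowMin, rowCoeff,
      (isChainSystem_row T.S).chainCoeff_least _ (isLeast_rowMin R)]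
    simp

theorem single_mem_idealD {r s : Fin n} (c : F) (h : (r, s) ∈ up T.S.lam 0)
    (h1 : (r, s) ∉ T.S.lam) (h2 : (r, s) ∉ T.S.nu) : Matrix.single r s c ∈ idealD T := by
  have : Matrix.single r s (1 : F) ∈ idealD T :=
    Submodule.subset_span (Or.inl ⟨(r, s), h, h1, h2, rfl⟩)
  have := (idealD T).smul_mem c this
  rwa [Matrix.smul_single, smul_eq_mul, mul_one] at this

theorem binding_mem_idealD (b : Binding T.S) :
    Matrix.single b.i b.k (1 : F) - (T.σ b : F) • Matrix.single b.j b.l (1 : F) ∈ idealD T :=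
  Submodule.subset_span (Or.inr ⟨b, rfl⟩)

theorem idealD_le {P : Submodule F (Matrix (Fin n) (Fin n) F)}
    (h1 : ∀ r s, (r, s) ∈ up T.S.lam 0 → (r, s) ∉ T.S.lam → (r, s) ∉ T.S.nu →
      Matrix.single r s 1 ∈ P)
    (h2 : ∀ b : Binding T.S,
      Matrix.single b.i b.k (1 : F) - (T.σ b : F) • Matrix.single b.j b.l (1 : F) ∈ P) :
    idealD T ≤ P := by
  refine Submodule.span_le.2 ?_
  rintro _ (⟨⟨r, s⟩, h, h3, h4, rfl⟩ | ⟨b, rfl⟩)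
  · exact h1 r s h h3 h4
  · exact h2 b

/-- Column coordinates see only positions of `lam`. Along a row the weight changes by `σ⁻¹` at each
binding, which cancels `e_{i,k} - σ e_{j,l}`. -/
theorem coord_idealD : idealD T ≤ LinearMap.ker (coord T) := by
  refine idealD_le T (fun r s _ h1 h2 => ?_) fun b => ?_
  · rw [LinearMap.mem_ker]
    have hne : ∀ e : Fin n × Fin n, e ≠ (r, s) → Matrix.single r s (1 : F) e.1 e.2 = 0 := by
      intro e he
      rw [Matrix.single_apply, if_neg]
      rintro ⟨rfl, rfl⟩
      exact he rfl
    ext X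
    rcases X with C | R
    · rw [coord_col]
      exact hne _ fun h => h1 (h ▸ (colMin C).2)
    · exact coord_row_eq_zero T (fun e he => hne e fun h => h2 (h ▸ he)) R
  · have e1 := coord_single_nu T ⟨(b.i, b.k), b.left⟩ 1
    have e2 := coord_single_nu T ⟨(b.j, b.l), b.right⟩ 1
    have e3 : rowCoeff T ⟨(b.j, b.l), b.right⟩ = (T.σ b)⁻¹ * rowCoeff T ⟨(b.i, b.k), b.left⟩ :=
      (isChainSystem_row T.S).chainCoeff_bot (fun b => (T.σ b)⁻¹) b
    have e4 := (isChainSystem_row T.S).mk_top b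
    dsimp only at e1 e2 e4
    rw [LinearMap.mem_ker, map_sub, map_smul, e1, e2, e3, e4, ← Pi.single_smul, ← Pi.single_sub]
    simp

theorem apply_eq_zero_of_mem_idealD {a : Matrix (Fin n) (Fin n) F} (ha : a ∈ idealD T)
    {e : Fin n × Fin n} (he : e ∈ T.S.lam) : a e.1 e.2 = 0 := by
  have hne : ∀ r s, (r, s) ∉ T.S.lam → Matrix.single r s (1 : F) e.1 e.2 = 0 := by
    intro r s h
    rw [Matrix.single_apply, if_neg]
    rintro ⟨rfl, rfl⟩
    exact h he
  have : idealD T ≤ LinearMap.ker (Matrix.entryLinearMap F F e.1 e.2) := by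
    refine idealD_le T (fun r s _ h1 _ => hne r s h1) fun b => ?_
    rw [LinearMap.mem_ker, Matrix.entryLinearMap_apply, Matrix.sub_apply, Matrix.smul_apply,
      hne _ _ (T.S.notMem_lam b.left), hne _ _ (T.S.notMem_lam b.right), smul_zero, sub_zero]
  exact this ha

/-- The linear combination of the vectors of columns and rows with given coefficients. -/
noncomputable def comb : (CR T.S → F) →ₗ[F] Matrix (Fin n) (Fin n) F :=
  Fintype.linearCombination F (basisVec T)

theorem comb_apply (w : CR T.S → F) : comb T w = ∑ X, w X • basisVec T X :=
  Fintype.linearCombination_apply F _ w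

theorem comb_single (X : CR T.S) : comb T (Pi.single X 1) = basisVec T X := by
  classical
  rw [comb_apply, Finset.sum_eq_single X] <;> simp +contextual

theorem coord_comb (w : CR T.S → F) : coord T (comb T w) = w := by
  rw [comb_apply, map_sum]
  simp only [map_smul, coord_basisVec]
  ext X
  rw [Finset.sum_apply, Finset.sum_eq_single X] <;> simp +contextual [eq_comm]

theorem comb_apply_lam (w : CR T.S → F) (e : {e // e ∈ T.S.lam}) :
    comb T w e.1.1 e.1.2 = (colCoeff T e : F) * w (.col (Quot.mk _ e)) := by
  rw [comb_apply, Matrix.sum_apply, Finset.sum_eq_single (.col (Quot.mk _ e))]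
  · rw [Matrix.smul_apply, basisVec_col_apply T _ e rfl, smul_eq_mul, mul_comm]
  · intro X _ hX
    rw [Matrix.smul_apply]
    rcases X with C | R
    · rw [basisVec_col_apply_of_notMem, smul_zero]
      rintro ⟨_, h⟩
      exact hX (by rw [← h])
    · rw [basisVec_row, Matrix.single_apply, if_neg, smul_zero]
      rintro ⟨h1, h2⟩
      have h3 : (rowMin R).1 = e.1 := Prod.ext h1 h2
      exact T.S.notMem_lam (rowMin R).2 (h3 ▸ e.2)
  · simp

theorem genVec_eq (Q : LabeledMatroid F (CR T.S)) (X : CR T.S) :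
    genVec T Q X = comb T (Q.rowVec X) := by
  classical
  rw [genVec, LabeledMatroid.rowVec, map_add, comb_single, comb_apply]
  congr 1
  refine Finset.sum_of_injOn (fun e => e.1.2) ?_
    (fun _ _ => Finset.mem_coe.2 (Finset.mem_univ _)) ?_ ?_
  · rintro ⟨⟨x, y⟩, h⟩ hx ⟨⟨x', y'⟩, h'⟩ hx' hyy
    simp only [Finset.coe_filter, Finset.mem_univ, true_and, Set.mem_ofPred_eq] at hx hx' hyy
    subst hx hx' hyy
    rfl
  · intro Y _ hY
    rw [Q.weight_eq_zero, zero_smul]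
    intro h
    exact hY ⟨⟨(X, Y), h⟩, by simp, rfl⟩
  · rintro ⟨⟨x, y⟩, h⟩ hx
    simp only [Finset.mem_filter, Finset.mem_univ, true_and] at hx
    subst hx
    rw [Q.weight_of_mem h]

/-- The predicate of being a column. -/
def IsCol {S : TightSplice n} (X : CR S) : Prop := ∃ C, X = CR.col C

theorem idealN_eq (Q : LabeledMatroid F (CR T.S)) :
    idealN T Q = (Q.space IsCol).map (comb T) ⊔ idealD T := by
  rw [idealN, LabeledMatroid.space, Submodule.map_span]
  congr 2
  ext a
  constructor
  · rintro ⟨X, h1, h2, rfl⟩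
    exact ⟨_, ⟨X, ⟨h1, h2⟩, rfl⟩, (genVec_eq T Q X).symm⟩
  · rintro ⟨_, ⟨X, h, rfl⟩, rfl⟩
    exact ⟨X, h.1, h.2, (genVec_eq T Q X).symm⟩

theorem coord_mem_of_mem_idealN {Q : LabeledMatroid F (CR T.S)} {a : Matrix (Fin n) (Fin n) F}
    (ha : a ∈ idealN T Q) : coord T a ∈ Q.space IsCol := by
  rw [idealN_eq, Submodule.mem_sup] at ha
  obtain ⟨_, ⟨w, hw, rfl⟩, d, hd, rfl⟩ := ha
  rwa [map_add, coord_comb, LinearMap.mem_ker.1 (coord_idealD T hd), add_zero]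

theorem comb_mem_idealN {Q : LabeledMatroid F (CR T.S)} {w : CR T.S → F}
    (hw : w ∈ Q.space IsCol) : comb T w ∈ idealN T Q := by
  rw [idealN_eq]
  exact Submodule.mem_sup_left (Submodule.mem_map_of_mem hw)

theorem idealD_le_idealN (Q : LabeledMatroid F (CR T.S)) : idealD T ≤ idealN T Q := le_sup_right

theorem space_eq_map_coord (Q : LabeledMatroid F (CR T.S)) :
    Q.space IsCol = (idealN T Q).map (coord T) := by
  ext w
  constructor
  · intro hw
    exact ⟨comb T w, comb_mem_idealN T hw, coord_comb T w⟩
  · rintro ⟨a, ha, rfl⟩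
    exact coord_mem_of_mem_idealN T ha

theorem apply_lam_of_mem_idealN {Q : LabeledMatroid F (CR T.S)} {a : Matrix (Fin n) (Fin n) F}
    (ha : a ∈ idealN T Q) (e : {e // e ∈ T.S.lam}) :
    a e.1.1 e.1.2 = (colCoeff T e : F) * coord T a (.col (Quot.mk _ e)) := by
  rw [idealN_eq, Submodule.mem_sup] at ha
  obtain ⟨_, ⟨w, hw, rfl⟩, d, hd, rfl⟩ := ha
  rw [map_add, coord_comb, LinearMap.mem_ker.1 (coord_idealD T hd), add_zero, Matrix.add_apply,
    apply_eq_zero_of_mem_idealD T hd e.2, add_zero, comb_apply_lam]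

theorem apply_binding_of_mem_idealN {Q : LabeledMatroid F (CR T.S)}
    {a : Matrix (Fin n) (Fin n) F} (ha : a ∈ idealN T Q) (b : Binding T.S) :
    a b.k b.l = (T.σ b : F) * a b.i b.j := by
  have h1 := apply_lam_of_mem_idealN T ha ⟨(b.i, b.j), b.top⟩
  have h2 := apply_lam_of_mem_idealN T ha ⟨(b.k, b.l), b.bottom⟩
  have h3 : colCoeff T ⟨(b.k, b.l), b.bottom⟩ = T.σ b * colCoeff T ⟨(b.i, b.j), b.top⟩ :=
    (isChainSystem_col T.S).chainCoeff_bot T.σ b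
  have h4 := (isChainSystem_col T.S).mk_top b
  dsimp only at h1 h2 h4
  rw [h1, h2, h3, h4, Units.val_mul, mul_assoc]

theorem idealD_le_level : idealD T ≤ level F T.S.lam 0 := by
  refine idealD_le T (fun r s h _ _ => single_mem_level 1 h) fun b => ?_
  exact Submodule.sub_mem _ (single_mem_level 1 (T.S.nu_subset_up b.left))
    (Submodule.smul_mem _ _ (single_mem_level 1 (T.S.nu_subset_up b.right)))

theorem comb_mem_level (w : CR T.S → F) : comb T w ∈ level F T.S.lam 0 := by
  rw [comb_apply]
  refine Submodule.sum_mem _ fun X _ => Submodule.smul_mem _ _ ?_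
  rcases X with C | R
  · intro r s h
    by_contra hup
    refine h (basisVec_col_apply_of_notMem T C ?_)
    rintro ⟨h1, -⟩
    exact hup (up_self T.S.splice.lam_partition h1)
  · rw [basisVec_row]
    exact single_mem_level 1 (T.S.nu_subset_up (rowMin R).2)

theorem idealN_le_level (Q : LabeledMatroid F (CR T.S)) : idealN T Q ≤ level F T.S.lam 0 := by
  rw [idealN_eq]
  refine sup_le ?_ (idealD_le_level T)
  rintro _ ⟨w, -, rfl⟩
  exact comb_mem_level T w

/-- This is condition (T): no edge of the splice is in level 2. -/
theorem level_le_idealD : level F T.S.lam 2 ≤ idealD T := fun _ ha =>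
  mem_of_level (P := (idealD T).toAddSubmonoid) ha fun _ _ c h =>
    single_mem_idealD T c (up_anti _ (Nat.zero_le _) h) (fun h1 => T.S.tight _ (Or.inl h1) h)
      fun h1 => T.S.tight _ (Or.inr h1) h

/-- By (S2), either both leading terms sit on vertical edges of a binding and combine to a multiple
of its generator, or neither sits in `nu` and each is in `idealD` separately. -/
theorem part_mem_idealD {a : Matrix (Fin n) (Fin n) F}
    (ha : ∀ b : Binding T.S, a b.k b.l = (T.σ b : F) * a b.i b.j) {j k : Fin n}
    (hjk : j.val + 1 = k.val) :
    rightPart T.S.lam a j k - leftPart T.S.lam a j k ∈ idealD T := by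
  have hlt : j < k := Fin.lt_def.2 (by omega)
  have hl := T.S.splice.lam_partition
  by_cases h : ∃ i, (i, k) ∈ T.S.nu ∧ (i, j) ∈ T.S.lam
  · obtain ⟨l, h1, h2⟩ := (T.S.splice.s2 j k hlt).1 h
    obtain ⟨i, h3, h4⟩ := h
    let b : Binding T.S := ⟨i, j, k, l, h4, h1, h3, h2, hlt⟩
    have h5 := (idealD T).smul_mem (-(a i j)) (binding_mem_idealD T b)
    rw [rightPart_eq hl a j h1, leftPart_eq hl a k h4, ha b]
    convert h5 using 1
    simp only [b, smul_sub, neg_smul, Matrix.smul_single, smul_eq_mul, mul_one,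
      one_mul, mul_comm (a i j)]
    abel
  · have h' := h
    rw [T.S.splice.s2 j k hlt] at h'
    refine Submodule.sub_mem _ (Submodule.sum_mem _ fun l _ => ?_)
      (Submodule.sum_mem _ fun i _ => ?_)
    · split_ifs with h1
      · have h2 : j < l := hlt.trans (hl.increasing _ h1)
        have h3 : (j, l) ∈ up T.S.lam 1 :=
          mem_up_iff.2 ⟨h2, k, l, h1, by have := hl.increasing _ h1; simp only at this; omega⟩
        exact single_mem_idealD T _ (up_anti _ (Nat.zero_le _) h3)
          (fun h4 => T.S.nonnesting.notMem_up_one h4 h3) fun h4 => h' ⟨l, h1, h4⟩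
      · exact Submodule.zero_mem _
    · split_ifs with h1
      · have h2 : i < k := (hl.increasing _ h1).trans hlt
        have h3 : (i, k) ∈ up T.S.lam 1 :=
          mem_up_iff.2 ⟨h2, i, j, h1, by have := hl.increasing _ h1; simp only at this; omega⟩
        exact single_mem_idealD T _ (up_anti _ (Nat.zero_le _) h3)
          (fun h4 => T.S.nonnesting.notMem_up_one h4 h3) fun h4 => h ⟨i, h4, h1⟩
      · exact Submodule.zero_mem _

theorem adapted_idealN (Q : LabeledMatroid F (CR T.S)) :
    Adapted T.S.lam (idealN T Q : Set (Matrix (Fin n) (Fin n) F)) (idealN T Q) where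
  nonnesting := T.S.nonnesting
  supp a ha := idealN_le_level T Q ha
  hit i j hij := by
    obtain ⟨w, hw, hne⟩ := Q.exists_mem_space_ne_zero IsCol
      (x := .col (Quot.mk _ ⟨(i, j), hij⟩)) (Or.inr ⟨_, rfl⟩)
    refine ⟨comb T w, comb_mem_idealN T hw, ?_⟩
    rw [comb_apply_lam T w ⟨(i, j), hij⟩]
    exact mul_ne_zero (Units.ne_zero _) hne
  level_le := (level_le_idealD T).trans (idealD_le_idealN T Q)
  comm a ha b hb := by
    have hD := (level_le_idealD T).trans (idealD_le_idealN T Q)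
    have hsupp := idealN_le_level T Q ha
    rw [Matrix.matrix_eq_sum_single b]
    simp only [Finset.sum_mul, Finset.mul_sum, ← Finset.sum_sub_distrib]
    refine Submodule.sum_mem _ fun j _ => Submodule.sum_mem _ fun k _ => ?_
    by_cases h0 : b j k = 0
    · simp [h0]
    have h1 := hb j k h0
    -- A matrix unit of height at least 2 sends commutators straight into level 2; only height 1
    -- involves the bindings.
    by_cases h2 : j.val + 2 ≤ k.val
    · exact hD (comm_single_mem_level hsupp _ h2)
    · have hjk : j.val + 1 = k.val := by omega
      have h3 := idealD_le_idealN T Q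
        (part_mem_idealD T (apply_binding_of_mem_idealN T ha) hjk)
      have h4 := hD (mul_single_sub_leftPart hsupp hjk)
      have h5 := hD (single_mul_sub_rightPart hsupp hjk)
      have h6 := Submodule.smul_mem _ (b j k)
        (Submodule.add_mem _ (Submodule.sub_mem _ h5 h4) h3)
      convert h6 using 1
      have h7 : Matrix.single j k (b j k) = b j k • Matrix.single j k (1 : F) := by simp
      rw [h7, Matrix.smul_mul, Matrix.mul_smul, ← smul_sub]
      congr 1
      abel

theorem single_notMem_idealN (Q : LabeledMatroid F (CR T.S)) {e : Fin n × Fin n}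
    (he : e ∈ T.S.nu) : Matrix.single e.1 e.2 (1 : F) ∉ idealN T Q := by
  intro h
  have h1 := coord_mem_of_mem_idealN T h
  rw [coord_single_nu T ⟨e, he⟩] at h1
  have h2 := Submodule.smul_mem _ ((rowCoeff T ⟨e, he⟩ : F)⁻¹) h1
  rw [← Pi.single_smul, mul_one, smul_eq_mul, inv_mul_cancel₀ (Units.ne_zero _)] at h2
  refine Q.single_notMem_space IsCol ?_ h2
  rintro ⟨C, hC⟩
  simp at hC

/-- This characterizes `nu` by the subspace once `lam` is known. -/
theorem mem_nu_iff (Q : LabeledMatroid F (CR T.S)) {e : Fin n × Fin n} :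
    e ∈ T.S.nu ↔ e ∈ up T.S.lam 0 ∧ e ∉ T.S.lam ∧ Matrix.single e.1 e.2 (1 : F) ∉ idealN T Q := by
  constructor
  · intro h
    exact ⟨T.S.nu_subset_up h, T.S.notMem_lam h, single_notMem_idealN T Q h⟩
  · rintro ⟨h1, h2, h3⟩
    by_contra h4
    exact h3 (idealD_le_idealN T Q (single_mem_idealD T 1 h1 h2 h4))

end coordinates

/-! ### Recovering the combinatorial data from the subspace -/

section injectivity

variable {F : Type*} [Field F] {n : ℕ}

theorem TightSplice.eq_of_sets {S S' : TightSplice n} (h1 : S.lam = S'.lam) (h2 : S.nu = S'.nu) :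
    S = S' := by
  obtain ⟨⟩ := S
  obtain ⟨⟩ := S'
  dsimp only at h1 h2
  subst h1 h2
  rfl

theorem idealN_injective :
    Function.Injective fun x : (Σ T : LabeledSplice F n, LabeledMatroid F (CR T.S)) =>
      idealN x.1 x.2 := by
  rintro ⟨T, Q⟩ ⟨T', Q'⟩ h
  dsimp only at h
  have hlam : T.S.lam = T'.S.lam := by
    rw [(adapted_idealN T Q).eq_minSupport, (adapted_idealN T' Q').eq_minSupport, h]
  have hS : T.S = T'.S := by
    refine TightSplice.eq_of_sets hlam ?_
    ext e
    rw [mem_nu_iff T Q, mem_nu_iff T' Q', hlam, h]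
  obtain ⟨S, σ⟩ := T
  obtain ⟨S', σ'⟩ := T'
  dsimp only at hS
  subst hS
  have hσ : σ = σ' := by
    ext b
    obtain ⟨a, ha, hne⟩ := (adapted_idealN ⟨S, σ⟩ Q).hit b.i b.j b.top
    have h1 := apply_binding_of_mem_idealN ⟨S, σ⟩ ha b
    have h2 := apply_binding_of_mem_idealN ⟨S, σ'⟩ (Q := Q') (a := a) (h ▸ ha) b
    exact mul_right_cancel₀ hne (h1.symm.trans h2)
  subst hσ
  have hQ : Q = Q' := by
    refine LabeledMatroid.space_injective IsCol ?_
    dsimp only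
    rw [space_eq_map_coord ⟨S, σ⟩ Q, space_eq_map_coord ⟨S, σ⟩ Q', h]
  rw [hQ]

end injectivity

/-! ### Reconstructing the combinatorial data -/

section residual

variable {F : Type*} [Field F] {n : ℕ} (T : LabeledSplice F n)

theorem single_sub_mem_idealD (f : {e // e ∈ T.S.nu}) :
    Matrix.single f.1.1 f.1.2 (1 : F) -
      (rowCoeff T f : F) • basisVec T (.row (Quot.mk _ f)) ∈ idealD T := by
  have h := (isChainSystem_row T.S).eq_chainCoeff_smul (fun b => (T.σ b)⁻¹)
    (fun e => (idealD T).mkQ (Matrix.single e.1.1 e.1.2 (1 : F))) (fun b => ?_)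
    (isLeast_rowMin (Quot.mk _ f)) f (mk_rowMin _).symm
  · rw [← (Submodule.Quotient.mk_eq_zero _), ← Submodule.mkQ_apply, map_sub, map_smul,
      basisVec_row, sub_eq_zero]
    exact h
  · rw [eq_inv_smul_iff, Units.smul_def, ← map_smul, eq_comm, ← sub_eq_zero, ← map_sub,
      Submodule.mkQ_apply, Submodule.Quotient.mk_eq_zero]
    exact binding_mem_idealD T b

/-- Modulo `idealD`, units outside the splice vanish and each vertical unit is a multiple of its row
vector, so only the row coordinates remain. -/
theorem mem_idealD_of_coord_eq_zero {a : Matrix (Fin n) (Fin n) F} (ha : a ∈ level F T.S.lam 0)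
    (hlam : ∀ e ∈ T.S.lam, a e.1 e.2 = 0) (hc : coord T a = 0) : a ∈ idealD T := by
  classical
  let _ : Fintype (Row T.S) := Fintype.ofFinite _
  set v : Matrix (Fin n) (Fin n) F :=
    ∑ f : {e // e ∈ T.S.nu}, a f.1.1 f.1.2 • Matrix.single f.1.1 f.1.2 (1 : F) with hv
  have hvapp : ∀ r s, v r s = if (r, s) ∈ T.S.nu then a r s else 0 := by
    intro r s
    rw [hv, Matrix.sum_apply]
    split_ifs with h
    · rw [Finset.sum_eq_single ⟨(r, s), h⟩]
      · simp
      · intro f _ hf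
        rw [Matrix.smul_apply, Matrix.single_apply, if_neg, smul_zero]
        rintro ⟨h1, h2⟩
        exact hf (Subtype.ext (Prod.ext h1 h2))
      · simp
    · refine Finset.sum_eq_zero fun f _ => ?_
      rw [Matrix.smul_apply, Matrix.single_apply, if_neg, smul_zero]
      rintro ⟨rfl, rfl⟩
      exact h f.2
  have h1 : a - v ∈ idealD T := by
    rw [Matrix.matrix_eq_sum_single (a - v)]
    refine Submodule.sum_mem _ fun r _ => Submodule.sum_mem _ fun s _ => ?_
    by_cases h0 : (a - v) r s = 0
    · rw [h0, Matrix.single_zero]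
      exact Submodule.zero_mem _
    rw [Matrix.sub_apply, hvapp] at h0
    have hnu : (r, s) ∉ T.S.nu := fun h => h0 (by simp [h])
    rw [if_neg hnu, sub_zero] at h0
    exact single_mem_idealD T _ (ha r s h0) (fun h => h0 (hlam _ h)) hnu
  have h2 : v - ∑ f : {e // e ∈ T.S.nu}, ((rowCoeff T f : F) * a f.1.1 f.1.2) •
      basisVec T (.row (Quot.mk _ f)) ∈ idealD T := by
    rw [hv, ← Finset.sum_sub_distrib]
    refine Submodule.sum_mem _ fun f _ => ?_
    have := (idealD T).smul_mem (a f.1.1 f.1.2) (single_sub_mem_idealD T f)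
    rwa [smul_sub, smul_smul, mul_comm] at this
  have h3 : ∑ f : {e // e ∈ T.S.nu}, ((rowCoeff T f : F) * a f.1.1 f.1.2) •
      basisVec T (.row (Quot.mk _ f)) = 0 := by
    rw [← Finset.sum_fiberwise (s := Finset.univ) (g := fun f => Quot.mk (RowStep T.S) f)]
    refine Finset.sum_eq_zero fun R _ => ?_
    have h4 := congrFun hc (.row R)
    rw [coord_row, ← Finset.sum_filter] at h4
    calc _ = ∑ f : {e // e ∈ T.S.nu} with Quot.mk (RowStep T.S) f = R,
          ((rowCoeff T f : F) * a f.1.1 f.1.2) • basisVec T (.row R) :=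
          Finset.sum_congr rfl fun f hf => by rw [(Finset.mem_filter.1 hf).2]
      _ = 0 := by
          rw [← Finset.sum_smul, h4]
          exact zero_smul _ _
  rw [h3, sub_zero] at h2
  simpa using (idealD T).add_mem h1 h2

theorem sub_comb_coord_mem_idealD {a : Matrix (Fin n) (Fin n) F} (ha : a ∈ level F T.S.lam 0)
    (hb : ∀ b : Binding T.S, a b.k b.l = (T.σ b : F) * a b.i b.j) :
    a - comb T (coord T a) ∈ idealD T := by
  refine mem_idealD_of_coord_eq_zero T (Submodule.sub_mem _ ha (comb_mem_level T _))
    (fun e he => ?_) ?_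
  · rw [Matrix.sub_apply, comb_apply_lam T _ ⟨e, he⟩, coord_col, sub_eq_zero]
    exact (isChainSystem_col T.S).eq_chainCoeff_smul T.σ (fun e => a e.1.1 e.1.2) hb
      (isLeast_colMin _) ⟨e, he⟩ (mk_colMin _).symm
  · rw [map_sub, coord_comb, sub_self]

end residual

/-! ### From an adapted subspace to a labeled splice and matroid -/

section reconstruction

variable {F : Type*} [Field F] {n : ℕ} {lam : Finset (Fin n × Fin n)}
  {A : Submodule F (Matrix (Fin n) (Fin n) F)}

open Classical in
/-- The positions above `lam` whose matrix units are not in `A`. -/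
noncomputable def missing (lam : Finset (Fin n × Fin n))
    (A : Submodule F (Matrix (Fin n) (Fin n) F)) : Finset (Fin n × Fin n) :=
  {e | e ∈ up lam 0 ∧ e ∉ lam ∧ Matrix.single e.1 e.2 (1 : F) ∉ A}

theorem mem_missing {e : Fin n × Fin n} :
    e ∈ missing lam A ↔ e ∈ up lam 0 ∧ e ∉ lam ∧ Matrix.single e.1 e.2 (1 : F) ∉ A := by
  simp [missing]

namespace Adapted

theorem notMem_up_two_of_missing (h : Adapted lam (A : Set (Matrix (Fin n) (Fin n) F)) A)
    {e : Fin n × Fin n} (he : e ∈ missing lam A) :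
    e ∉ up lam 2 := fun h2 =>
  (mem_missing.1 he).2.2 (h.level_le (single_mem_level 1 h2))

/-- A missing position is already in level 1, so anything strictly above it in the same row or
column of the matrix is in level 2 and cannot be missing. -/
theorem isSetPartition_missing (h : Adapted lam (A : Set (Matrix (Fin n) (Fin n) F)) A) : IsSetPartition (missing lam A) where
  increasing e he := (mem_missing.1 he).1.1
  antichainL := by
    rintro ⟨i, j⟩ he ⟨r, s⟩ hf hne ⟨h1, h2⟩
    dsimp only at h1 h2
    subst h2
    obtain ⟨h3, h4, -⟩ := mem_missing.1 he
    obtain ⟨h5, k, l, h6, h7⟩ := mem_up_iff.1 (mem_up_one h3 h4)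
    have h8 : r ≠ i := fun h8 => hne (by rw [h8])
    rw [Fin.le_def] at h1
    refine h.notMem_up_two_of_missing hf (mem_up_iff.2 ⟨by omega, k, l, h6, by omega⟩)
  antichainR := by
    rintro ⟨i, j⟩ he ⟨r, s⟩ hf hne ⟨h1, h2⟩
    dsimp only at h1 h2
    subst h1
    obtain ⟨h3, h4, -⟩ := mem_missing.1 he
    obtain ⟨h5, k, l, h6, h7⟩ := mem_up_iff.1 (mem_up_one h3 h4)
    have h8 : j ≠ s := fun h8 => hne (by rw [h8])
    rw [Fin.le_def] at h2
    refine h.notMem_up_two_of_missing hf (mem_up_iff.2 ⟨by omega, k, l, h6, by omega⟩)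

theorem val_succ_of_left (h : Adapted lam (A : Set (Matrix (Fin n) (Fin n) F)) A)
    {i j k : Fin n} (hjk : j < k) (h1 : (i, k) ∈ missing lam A)
    (h2 : (i, j) ∈ lam) : j.val + 1 = k.val := by
  by_contra hne
  have h3 := h.nonnesting.increasing _ h2
  dsimp only at h3
  exact h.notMem_up_two_of_missing h1 (mem_up_iff.2 ⟨by omega, i, j, h2, by omega⟩)

theorem val_succ_of_right (h : Adapted lam (A : Set (Matrix (Fin n) (Fin n) F)) A)
    {j k l : Fin n} (hjk : j < k) (h1 : (j, l) ∈ missing lam A)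
    (h2 : (k, l) ∈ lam) : j.val + 1 = k.val := by
  by_contra hne
  have h3 := h.nonnesting.increasing _ h2
  dsimp only at h3
  exact h.notMem_up_two_of_missing h1 (mem_up_iff.2 ⟨by omega, k, l, h2, by omega⟩)

theorem mem_missing_left (h : Adapted lam (A : Set (Matrix (Fin n) (Fin n) F)) A)
    {i j k : Fin n} (hjk : j < k) (h1 : (i, j) ∈ lam)
    (h2 : Matrix.single i k (1 : F) ∉ A) : (i, k) ∈ missing lam A := by
  have h3 := h.nonnesting.increasing _ h1
  dsimp only at h3
  have h4 : (i, k) ∈ up lam 1 := mem_up_iff.2 ⟨by omega, i, j, h1, by omega⟩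
  exact mem_missing.2
    ⟨up_anti _ (Nat.zero_le _) h4, fun h5 => h.nonnesting.notMem_up_one h5 h4, h2⟩

theorem mem_missing_right (h : Adapted lam (A : Set (Matrix (Fin n) (Fin n) F)) A)
    {j k l : Fin n} (hjk : j < k) (h1 : (k, l) ∈ lam)
    (h2 : Matrix.single j l (1 : F) ∉ A) : (j, l) ∈ missing lam A := by
  have h3 := h.nonnesting.increasing _ h1
  dsimp only at h3
  have h4 : (j, l) ∈ up lam 1 := mem_up_iff.2 ⟨by omega, k, l, h1, by omega⟩
  exact mem_missing.2
    ⟨up_anti _ (Nat.zero_le _) h4, fun h5 => h.nonnesting.notMem_up_one h5 h4, h2⟩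

/-- For (S2), the difference of the two leading terms lies in `A`; if one of them is not in `A`, the
other is not either, and in particular it is nonzero. -/
theorem isSplice_missing (h : Adapted lam (A : Set (Matrix (Fin n) (Fin n) F)) A) : IsSplice lam (missing lam A) where
  lam_partition := h.nonnesting.toIsSetPartition
  nu_partition := h.isSetPartition_missing
  disjoint := Finset.disjoint_right.2 fun _ he => (mem_missing.1 he).2.1
  s1 := by
    intro i k hik
    obtain ⟨h1, h2, -⟩ := mem_missing.1 hik
    have h3 := h.notMem_up_two_of_missing hik
    obtain ⟨h4, r, s, h5, h6⟩ := mem_up_iff.1 (mem_up_one h1 h2)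
    rw [mem_up_iff] at h3
    have h7 : ¬ (s.val + i.val + 2 ≤ k.val + r.val) := fun h7 =>
      h3 ⟨h4, r, s, h5, by omega⟩
    by_cases h8 : r = i
    · subst h8
      exact ⟨s, Fin.lt_def.2 (by omega), Fin.lt_def.2 (by omega), Or.inl h5⟩
    · have h9 : r.val ≠ i.val := fun h9 => h8 (Fin.ext h9)
      obtain rfl : s = k := Fin.ext (by omega)
      exact ⟨r, Fin.lt_def.2 (by omega), Fin.lt_def.2 (by omega), Or.inr h5⟩
  s2 := by
    intro j k hjk
    have hl := h.nonnesting.toIsSetPartition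
    constructor
    · rintro ⟨i, h1, h2⟩
      have h3 := h.val_succ_of_left hjk h1 h2
      obtain ⟨a, ha, hne⟩ := h.hit i j h2
      have h4 := h.part_mem ha h3
      rw [leftPart_eq hl a k h2] at h4
      have h5 : rightPart lam a j k ∉ A := fun h5 =>
        (mem_missing.1 h1).2.2 (single_one_mem hne ((A.sub_mem_iff_right h5).1 h4))
      have h6 : ∃ l, (k, l) ∈ lam := by
        by_contra h6
        push Not at h6
        exact h5 (rightPart_eq_zero a j h6 ▸ A.zero_mem)
      obtain ⟨l, h6⟩ := h6
      rw [rightPart_eq hl a j h6] at h5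
      exact ⟨l, h6, h.mem_missing_right hjk h6 fun h7 => h5 (single_mem h7)⟩
    · rintro ⟨l, h2, h1⟩
      have h3 := h.val_succ_of_right hjk h1 h2
      obtain ⟨a, ha, hne⟩ := h.hit k l h2
      have h4 := h.part_mem ha h3
      rw [rightPart_eq hl a j h2] at h4
      have h5 : leftPart lam a j k ∉ A := fun h5 =>
        (mem_missing.1 h1).2.2 (single_one_mem hne ((A.sub_mem_iff_left h5).1 h4))
      have h6 : ∃ i, (i, j) ∈ lam := by
        by_contra h6
        push Not at h6
        exact h5 (leftPart_eq_zero a k h6 ▸ A.zero_mem)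
      obtain ⟨i, h6⟩ := h6
      rw [leftPart_eq hl a k h6] at h5
      exact ⟨i, h.mem_missing_left hjk h6 fun h7 => h5 (single_mem h7), h6⟩

/-- The tight splice of an adapted subspace. -/
noncomputable def tightSplice (h : Adapted lam (A : Set (Matrix (Fin n) (Fin n) F)) A) :
    TightSplice n where
  lam := lam
  nu := missing lam A
  nonnesting := h.nonnesting
  splice := h.isSplice_missing
  tight := by
    rintro e (he | he) h2
    · exact h.nonnesting.notMem_up_one he (up_anti lam one_le_two h2)
    · exact h.notMem_up_two_of_missing he h2

theorem binding_mem (h : Adapted lam (A : Set (Matrix (Fin n) (Fin n) F)) A)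
    (b : Binding h.tightSplice) {a : Matrix (Fin n) (Fin n) F} (ha : a ∈ A) :
    Matrix.single b.j b.l (a b.k b.l) - Matrix.single b.i b.k (a b.i b.j) ∈ A := by
  have hl := h.nonnesting.toIsSetPartition
  have h1 := h.part_mem ha (h.val_succ_of_left b.lt b.left b.top)
  rwa [rightPart_eq hl a b.j b.bottom, leftPart_eq hl a b.k b.top] at h1

theorem exists_label (h : Adapted lam (A : Set (Matrix (Fin n) (Fin n) F)) A)
    (b : Binding h.tightSplice) :
    ∃ c : Fˣ, (∀ a ∈ A, a b.k b.l = (c : F) * a b.i b.j) ∧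
      Matrix.single b.i b.k (1 : F) - (c : F) • Matrix.single b.j b.l (1 : F) ∈ A := by
  obtain ⟨a, ha, hne⟩ := h.hit b.i b.j b.top
  have h1 := h.binding_mem b ha
  have hik : Matrix.single b.i b.k (1 : F) ∉ A := (mem_missing.1 b.left).2.2
  have hjl : Matrix.single b.j b.l (1 : F) ∉ A := (mem_missing.1 b.right).2.2
  have hne' : a b.k b.l ≠ 0 := by
    intro h0
    rw [h0, Matrix.single_zero, zero_sub] at h1
    exact hik (single_one_mem hne (A.neg_mem_iff.1 h1))
  -- The label is the ratio of entries in one element `a`. For any other `c`, eliminating `e_{i,k}`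
  -- leaves a multiple of `e_{j,l}` in `A`, which must be zero.
  refine ⟨Units.mk0 (a b.k b.l / a b.i b.j) (div_ne_zero hne' hne), fun c hc => ?_, ?_⟩
  · have h2 := h.binding_mem b hc
    have h3 := A.sub_mem (A.smul_mem (a b.i b.j) h2) (A.smul_mem (c b.i b.j) h1)
    have h4 : Matrix.single b.j b.l (a b.i b.j * c b.k b.l - c b.i b.j * a b.k b.l) ∈ A := by
      convert h3 using 1
      have hsub : ∀ x y : F, Matrix.single b.j b.l (x - y) =
          Matrix.single b.j b.l x - Matrix.single b.j b.l y :=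
        map_sub (Matrix.singleAddMonoidHom b.j b.l)
      simp only [smul_sub, Matrix.smul_single, smul_eq_mul, hsub,
        mul_comm (c b.i b.j) (a b.i b.j)]
      abel
    have h5 : a b.i b.j * c b.k b.l - c b.i b.j * a b.k b.l = 0 := by
      by_contra h5
      exact hjl (single_one_mem h5 h4)
    rw [Units.val_mk0]
    field_simp
    linear_combination h5
  · have h2 := A.smul_mem (-(a b.i b.j)⁻¹) h1
    convert h2 using 1
    simp only [smul_sub, neg_smul, Matrix.smul_single, smul_eq_mul, Units.val_mk0, mul_one,
      inv_mul_cancel₀ hne, div_eq_inv_mul]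
    abel

theorem exists_idealN_eq (h : Adapted lam (A : Set (Matrix (Fin n) (Fin n) F)) A) :
    ∃ (T : LabeledSplice F n) (Q : LabeledMatroid F (CR T.S)), idealN T Q = A := by
  choose σ hσ hσA using h.exists_label
  let T : LabeledSplice F n := ⟨h.tightSplice, σ⟩
  have hD : idealD T ≤ A := by
    refine idealD_le T (fun r s h1 h2 h3 => ?_) hσA
    by_contra h4
    exact h3 (mem_missing.2 ⟨h1, h2, h4⟩)
  have hres : ∀ a ∈ A, a - comb T (coord T a) ∈ idealD T := fun a ha =>
    sub_comb_coord_mem_idealD T (h.supp a ha) fun b => hσ b a ha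
  have hcomb : ∀ a ∈ A, comb T (coord T a) ∈ A := fun a ha =>
    (A.sub_mem_iff_right ha).1 (hD (hres a ha))
  have hcol : ∀ X : CR T.S, IsCol X → ∃ w ∈ A.map (coord T), w X ≠ 0 := by
    rintro _ ⟨C, rfl⟩
    obtain ⟨a, ha, hne⟩ := h.hit _ _ (colMin C).2
    exact ⟨_, Submodule.mem_map_of_mem ha, hne⟩
  -- A unit vector at a row would put the row's first matrix unit in `A`, although it is missing.
  have hrow : ∀ X : CR T.S, ¬ IsCol X → (Pi.single X 1 : CR T.S → F) ∉ A.map (coord T) := by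
    rintro (C | R) hX
    · exact absurd ⟨C, rfl⟩ hX
    · rintro ⟨a, ha, hax⟩
      have h1 := hcomb a ha
      rw [hax, comb_single, basisVec_row] at h1
      exact (mem_missing.1 (rowMin R).2).2.2 h1
  obtain ⟨Q, hQ⟩ := LabeledMatroid.exists_space_eq IsCol (A.map (coord T)) hcol hrow
  refine ⟨T, Q, ?_⟩
  rw [idealN_eq, hQ]
  apply le_antisymm
  · refine sup_le ?_ hD
    rintro _ ⟨_, ⟨a, ha, rfl⟩, rfl⟩
    exact hcomb a ha
  · intro a ha
    rw [← add_sub_cancel (comb T (coord T a)) a]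
    exact Submodule.add_mem_sup (Submodule.mem_map_of_mem (Submodule.mem_map_of_mem ha))
      (hres a ha)

end Adapted

end reconstruction

end SpliceUT

theorem mainTheorem2 (n p : ℕ) [Fact p.Prime] :
    ∃ Φ : (Σ T : SpliceUT.LabeledSplice (ZMod p) n,
          SpliceUT.LabeledMatroid (ZMod p) (SpliceUT.CR T.S)) →
        {N : Subgroup (SpliceUT.UT n (ZMod p)) // N.Normal},
      (∀ (T : SpliceUT.LabeledSplice (ZMod p) n)
          (Q : SpliceUT.LabeledMatroid (ZMod p) (SpliceUT.CR T.S)),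
        SpliceUT.matrices (Φ ⟨T, Q⟩).1 = {x | ∃ a ∈ SpliceUT.idealN T Q, x = 1 + a}) ∧
      Function.Bijective Φ := by
  choose N hN hNA using fun x : (Σ T : SpliceUT.LabeledSplice (ZMod p) n,
    SpliceUT.LabeledMatroid (ZMod p) (SpliceUT.CR T.S)) =>
      (SpliceUT.adapted_idealN x.1 x.2).exists_normal
  refine ⟨fun x => ⟨N x, hN x⟩, fun T Q => ?_, fun x y hxy => ?_, fun ⟨M, hM⟩ => ?_⟩
  · rw [SpliceUT.matrices_eq, hNA]
    rfl
  · refine SpliceUT.idealN_injective (SetLike.coe_injective ?_)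
    dsimp only
    rw [← hNA, ← hNA, Subtype.mk.inj hxy]
  · obtain ⟨A, hA, had⟩ := SpliceUT.exists_adapted_of_normal hM
    obtain ⟨T, Q, hTQ⟩ := had.exists_idealN_eq
    refine ⟨⟨T, Q⟩, Subtype.ext (SpliceUT.shifted_injective ?_)⟩
    dsimp only
    rw [hNA, hTQ, hA]
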